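/- For a positive integer $k$ let $R_k$ be the dihedral quandle: the set $\mathbb{Z}_k=\mathbb{Z}/k\mathbb{Z}$ with the operation $a*b=2b-a$. For a quandle $X$ let $C_n^R(X)$ be the free abelian group on $X^n$, with boundary $$\partial(x_1,\dots,x_n)=\sum_{i=2}^{n}(-1)^i\big((x_1,\dots,x_{i-1},x_{i+1},\dots,x_n)-(x_1*x_i,\dots,x_{i-1}*x_i,x_{i+1},\dots,x_n)\big),$$ let $C_n^D(X)\subset C_n^R(X)$ be the subgroup generated by the tuples with $x_i=x_{i+1}$ for some $i$ (this is a subcomplex), and let $C_n^Q(X)=C_n^R(X)/C_n^D(X)$. For $W\in\{R,D,Q\}$ let $H_n^W(X)$ be the $n$-th homology group of $C_*^W(X)$ (rack, degenerate and quandle homology, respectively), and let $\operatorname{tor}$ denote the torsion subgroup. Then, for all $n$ and all $W\in\{R,D,Q\}$: (i) If $m,k\ge 1$ and $\gcd(m,k)=1$, then $\mathbb{Z}_{mk}\cong\mathbb{Z}_m\oplus\mathbb{Z}_k$, and $\operatorname{tor}H_n^W(R_m)\oplus\operatorname{tor}H_n^W(R_k)$ embeds in $H_n^W(R_{mk})$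 (that is, there is an injective group homomorphism from the first group to the second). (ii) If $k$ is odd, then $\operatorname{tor}H_n^W(R_k)\oplus\operatorname{tor}H_n^W(R_k)$ embeds in $H_n^W(R_{2k})$. (iii) If $k$ is an odd prime and $\gcd(m,k)=1$ (with $m\ge 1$), then both $H_3^Q(R_{mk})$ and $H_4^Q(R_{mk})$ contain a subgroup isomorphic to $\mathbb{Z}_k$. -/

import Mathlib

noncomputable section

namespace QuandleHomology

universe u

/-- The right operation `a * b`. Mathlib's racks are written as left actions, so `a * b` is
`Shelf.act b a`. -/
def op {X : Type u} [Shelf X] (a b : X) : X := Shelf.act b a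

/-- The face map `∂⁰ᵢ (x₁, …, xₙ) = (x₁, …, xᵢ₋₁, xᵢ₊₁, …, xₙ)`. -/
def face0 {X : Type u} {n : ℕ} (i : Fin (n + 1)) (x : Fin (n + 1) → X) : Fin n → X :=
  fun j => x (i.succAbove j)

/-- The face map `∂¹ᵢ (x₁, …, xₙ) = (x₁ * xᵢ, …, xᵢ₋₁ * xᵢ, xᵢ₊₁, …, xₙ)`. -/
def face1 {X : Type u} [Shelf X] {n : ℕ} (i : Fin (n + 1)) (x : Fin (n + 1) → X) :
    Fin n → X :=
  fun j => if j.castSucc < i then op (x (i.succAbove j)) (x i) else x (i.succAbove j)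

/-- The group `Cₙᴿ(X)` of rack chains: the free abelian group on `n`-tuples of elements of `X`. -/
abbrev RackChain (X : Type u) (n : ℕ) : Type u := (Fin n → X) →₀ ℤ

/-- The linear map `∂⁰ᵢ - ∂¹ᵢ`. -/
def faceDiff (X : Type u) [Shelf X] {n : ℕ} (i : Fin (n + 1)) :
    RackChain X (n + 1) →ₗ[ℤ] RackChain X n :=
  Finsupp.lmapDomain ℤ ℤ (face0 i) - Finsupp.lmapDomain ℤ ℤ (face1 i)

/-- The rack boundary `∂ = ∑ᵢ (-1)ⁱ (∂⁰ᵢ - ∂¹ᵢ)`, with `i` running over `1, …, n + 1` in the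
mathematical numbering, that is `i.val + 1` below. The first term vanishes, since `∂⁰₁ = ∂¹₁`, so
this is the sum over `2, …, n + 1`. -/
def boundary (X : Type u) [Shelf X] (n : ℕ) : RackChain X (n + 1) →ₗ[ℤ] RackChain X n :=
  ∑ i : Fin (n + 1), (-1 : ℤ) ^ (i.val + 1) • faceDiff X i

theorem face0_face0 {X : Type u} {n : ℕ} (x : Fin (n + 2) → X) {i j : Fin (n + 1)}
    (h : i ≤ j) : face0 i (face0 j.succ x) = face0 j (face0 i.castSucc x) := by
  funext k
  simp only [face0]
  congr 1
  simp only [Fin.ext_iff, Fin.succAbove, Fin.lt_def, Fin.le_def] at *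
  grind

theorem face0_face1 {X : Type u} [Shelf X] {n : ℕ} (x : Fin (n + 2) → X)
    {i j : Fin (n + 1)} (h : i ≤ j) :
    face0 i (face1 j.succ x) = face1 j (face0 i.castSucc x) := by
  have e : ∀ k, j.succ.succAbove (i.succAbove k) = i.castSucc.succAbove (j.succAbove k) := by
    intro k
    simp only [Fin.ext_iff, Fin.succAbove, Fin.lt_def, Fin.le_def] at *
    grind
  have e2 : i.castSucc.succAbove j = j.succ := Fin.succAbove_castSucc_of_le _ _ h
  funext k
  simp only [face0, face1, e, e2]
  congr 1
  simp only [Fin.ext_iff, Fin.succAbove, Fin.lt_def, Fin.le_def] at *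
  grind

theorem face1_face0 {X : Type u} [Shelf X] {n : ℕ} (x : Fin (n + 2) → X)
    {i j : Fin (n + 1)} (h : i ≤ j) :
    face1 i (face0 j.succ x) = face0 j (face1 i.castSucc x) := by
  have e : ∀ k, j.succ.succAbove (i.succAbove k) = i.castSucc.succAbove (j.succAbove k) := by
    intro k
    simp only [Fin.ext_iff, Fin.succAbove, Fin.lt_def, Fin.le_def] at *
    grind
  have e2 : j.succ.succAbove i = i.castSucc := Fin.succAbove_succ_of_le _ _ h
  funext k
  simp only [face0, face1, e, e2]
  congr 1
  simp only [Fin.ext_iff, Fin.succAbove, Fin.lt_def, Fin.le_def] at *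
  grind

theorem face1_face1 {X : Type u} [Shelf X] {n : ℕ} (x : Fin (n + 2) → X)
    {i j : Fin (n + 1)} (h : i ≤ j) :
    face1 i (face1 j.succ x) = face1 j (face1 i.castSucc x) := by
  have e : ∀ k, j.succ.succAbove (i.succAbove k) = i.castSucc.succAbove (j.succAbove k) := by
    intro k
    simp only [Fin.ext_iff, Fin.succAbove, Fin.lt_def, Fin.le_def] at *
    grind
  have e1 : i.castSucc.succAbove j = j.succ := Fin.succAbove_castSucc_of_le _ _ h
  have e2 : j.succ.succAbove i = i.castSucc := Fin.succAbove_succ_of_le _ _ h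
  have c1 : i.castSucc < j.succ := by
    simp only [Fin.lt_def, Fin.le_def, Fin.val_castSucc, Fin.val_succ] at *; omega
  have c2 : ¬ j.castSucc < i.castSucc := by
    simp only [Fin.lt_def, Fin.le_def, Fin.val_castSucc] at *; omega
  funext k
  simp only [face1, e, e1, e2, c1, c2, if_true, if_false]
  have c3 : (i.succAbove k).castSucc < j.succ ↔ k.castSucc < j := by
    simp only [Fin.succAbove, Fin.lt_def, Fin.le_def] at *
    grind
  have c4 : (j.succAbove k).castSucc < i.castSucc ↔ k.castSucc < i := by
    simp only [Fin.succAbove, Fin.lt_def, Fin.le_def] at *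
    grind
  have c5 : k.castSucc < i → k.castSucc < j := fun hk => lt_of_lt_of_le hk h
  simp only [c3, c4]
  by_cases hi : k.castSucc < i
  · simp only [hi, c5 hi, if_true, op]
    exact (Shelf.self_distrib (α := X)).symm
  · simp only [hi, if_false]

theorem faceDiff_single (X : Type u) [Shelf X] {n : ℕ} (i : Fin (n + 1)) (x : Fin (n + 1) → X)
    (c : ℤ) : faceDiff X i (Finsupp.single x c) =
      Finsupp.single (face0 i x) c - Finsupp.single (face1 i x) c := by
  simp [faceDiff, Finsupp.mapDomain_single]

theorem faceDiff_comp {X : Type u} [Shelf X] {n : ℕ} {i j : Fin (n + 1)} (h : i ≤ j) :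
    faceDiff X i ∘ₗ faceDiff X j.succ = faceDiff X j ∘ₗ faceDiff X i.castSucc := by
  refine Finsupp.lhom_ext fun x c => ?_
  simp only [LinearMap.comp_apply, faceDiff_single, map_sub, face0_face0 x h, face0_face1 x h,
    face1_face0 x h, face1_face1 x h]
  abel

theorem boundary_comp (X : Type u) [Shelf X] (n : ℕ) :
    boundary X n ∘ₗ boundary X (n + 1) = 0 := by
  have hexp : boundary X n ∘ₗ boundary X (n + 1) =
      ∑ i : Fin (n + 1), ∑ j : Fin (n + 2),
        ((-1 : ℤ) ^ (i.val + 1) * (-1 : ℤ) ^ (j.val + 1)) • (faceDiff X i ∘ₗ faceDiff X j) := by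
    ext1 x
    ext1
    simp [boundary, Finset.smul_sum, smul_smul]
  rw [hexp]
  simp only [← Finset.sum_product']
  let P := Fin (n + 1) × Fin (n + 2)
  let S : Finset P := {ij : P | (ij.2 : ℕ) ≤ (ij.1 : ℕ)}
  rw [Finset.univ_product_univ, ← Finset.sum_add_sum_compl S, ← eq_neg_iff_add_eq_zero,
    ← Finset.sum_neg_distrib]
  let φ : ∀ ij : P, ij ∈ S → P := fun ij hij =>
    (Fin.castLT ij.2 (lt_of_le_of_lt (Finset.mem_filter.mp hij).right (Fin.is_lt ij.1)),
      ij.1.succ)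
  apply Finset.sum_bij φ
  · intro ij hij
    simp_rw [S, φ, Finset.compl_filter, Finset.mem_filter_univ, Fin.val_succ,
      Fin.val_castLT] at hij ⊢
    lia
  · rintro ⟨i, j⟩ hij ⟨i', j'⟩ hij' h
    have h1 := congrArg (fun p : P => p.1.val) h
    have h2 := congrArg (fun p : P => p.2.val) h
    simp only [φ, Fin.val_succ, Fin.val_castLT] at h1 h2
    exact Prod.ext (Fin.ext (by lia)) (Fin.ext h1)
  · rintro ⟨i', j'⟩ hij'
    simp_rw [S, Finset.compl_filter, Finset.mem_filter_univ, not_le] at hij'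
    refine ⟨(j'.pred <| ?_, Fin.castSucc i'), ?_, ?_⟩
    · rintro rfl
      simp only [Fin.val_zero, not_lt_zero] at hij'
    · simp only [S, Finset.mem_filter_univ, Fin.val_castSucc, Fin.val_pred]
      lia
    · simp only [φ, Fin.castLT_castSucc, Fin.succ_pred]
  · rintro ⟨i, j⟩ hij
    have hij2 : (j : ℕ) ≤ (i : ℕ) := by simpa [S] using hij
    have key := faceDiff_comp (X := X) (i := Fin.castLT j (lt_of_le_of_lt hij2 i.is_lt)) (j := i)
      (by simpa [Fin.le_def] using hij2)
    rw [Fin.castSucc_castLT] at key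
    simp only [φ, key, ← neg_smul, Fin.val_succ, Fin.val_castLT]
    congr 1
    ring

/-- The complex of rack chains of `X`. (In degree `0` it is `ℤ`, generated by the empty tuple; the
boundary from degree `1` to degree `0` is zero.) -/
def rackComplex (X : Type u) [Rack X] : ChainComplex (ModuleCat.{u} ℤ) ℕ :=
  ChainComplex.of (fun n => ModuleCat.of ℤ (RackChain X n))
    (fun n => ModuleCat.ofHom (boundary X n))
    (fun n => by rw [← ModuleCat.ofHom_comp, boundary_comp]; rfl)

/-- A tuple is degenerate if two consecutive entries agree. -/
def IsDegenerate {X : Type u} {n : ℕ} (x : Fin n → X) : Prop :=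
  ∃ i j : Fin n, j.val = i.val + 1 ∧ x i = x j

/-- The group `Cₙᴰ(X)` of degenerate chains, spanned by the degenerate tuples. -/
def degenerate (X : Type u) (n : ℕ) : Submodule ℤ (RackChain X n) :=
  Submodule.span ℤ {c | ∃ x : Fin n → X, IsDegenerate x ∧ c = Finsupp.single x 1}

theorem face_degenerate {X : Type u} [Shelf X] {n : ℕ} (x : Fin (n + 1) → X)
    {i j k : Fin (n + 1)} (hij : j.val = i.val + 1) (h : x i = x j) (hi : k ≠ i) (hj : k ≠ j) :
    IsDegenerate (face0 k x) ∧ IsDegenerate (face1 k x) := by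
  obtain ⟨a, rfl⟩ := Fin.exists_succAbove_eq hi.symm
  obtain ⟨b, rfl⟩ := Fin.exists_succAbove_eq hj.symm
  have hab : b.val = a.val + 1 := by
    simp only [Ne, Fin.ext_iff, Fin.succAbove, Fin.lt_def, Fin.val_castSucc] at *
    grind
  have hc : a.castSucc < k ↔ b.castSucc < k := by
    simp only [Ne, Fin.ext_iff, Fin.succAbove, Fin.lt_def, Fin.val_castSucc] at *
    grind
  exact ⟨⟨a, b, hab, h⟩, ⟨a, b, hab, by simp only [face1, hc, h]⟩⟩

theorem face_consecutive {X : Type u} [Quandle X] {n : ℕ} (x : Fin (n + 1) → X)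
    {i j : Fin (n + 1)} (hij : j.val = i.val + 1) (h : x i = x j) :
    face0 i x = face0 j x ∧ face1 i x = face1 j x := by
  have e : ∀ k : Fin n, k.val ≠ i.val → i.succAbove k = j.succAbove k := by
    intro k hk
    simp only [Fin.ext_iff, Fin.succAbove, Fin.lt_def, Fin.val_castSucc] at *
    grind
  have e1 : ∀ k : Fin n, k.val = i.val → i.succAbove k = j ∧ j.succAbove k = i := by
    intro k hk
    simp only [Fin.ext_iff, Fin.succAbove, Fin.lt_def, Fin.val_castSucc] at *
    grind
  constructor <;> funext k <;> by_cases hk : k.val = i.val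
  · simp only [face0, e1 k hk, h]
  · simp only [face0, e k hk]
  · have c1 : ¬ k.castSucc < i := by simp [Fin.lt_def, hk]
    have c2 : k.castSucc < j := by simp [Fin.lt_def, hk, hij]
    simp only [face1, e1 k hk, c1, c2, if_true, if_false, h, op]
    exact Quandle.fix.symm
  · have c : k.castSucc < i ↔ k.castSucc < j := by
      simp only [Fin.lt_def, Fin.val_castSucc]; lia
    simp only [face1, e k hk, c, h]

theorem boundary_degenerate (X : Type u) [Quandle X] (n : ℕ) :
    degenerate X (n + 1) ≤ (degenerate X n).comap (boundary X n) := by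
  refine Submodule.span_le.2 ?_
  rintro _ ⟨x, ⟨i, j, hij, h⟩, rfl⟩
  have hne : i ≠ j := by rintro rfl; lia
  have hb : boundary X n (Finsupp.single x 1) = ∑ k : Fin (n + 1), (-1 : ℤ) ^ (k.val + 1) •
      (Finsupp.single (face0 k x) (1 : ℤ) - Finsupp.single (face1 k x) 1) := by
    simp [boundary, faceDiff, LinearMap.sum_apply, Finsupp.mapDomain_single]
  obtain ⟨h0, h1⟩ := face_consecutive x hij h
  simp only [SetLike.mem_coe, Submodule.mem_comap]
  rw [hb, ← Finset.add_sum_erase _ _ (Finset.mem_univ i),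
    ← Finset.add_sum_erase _ _ (Finset.mem_erase.2 ⟨hne.symm, Finset.mem_univ j⟩), ← add_assoc,
    h0, h1, ← add_smul, hij]
  have hs : ((-1 : ℤ) ^ (i.val + 1) + (-1) ^ (i.val + 1 + 1)) = 0 := by ring
  rw [hs, zero_smul, zero_add]
  refine Submodule.sum_mem _ fun k hk => Submodule.smul_mem _ _ ?_
  simp only [Finset.mem_erase, Finset.mem_univ, and_true] at hk
  obtain ⟨d0, d1⟩ := face_degenerate x hij h hk.2 hk.1
  exact Submodule.sub_mem _ (Submodule.subset_span ⟨_, d0, rfl⟩)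
    (Submodule.subset_span ⟨_, d1, rfl⟩)

/-- The boundary of degenerate chains. -/
def degenerateBoundary (X : Type u) [Quandle X] (n : ℕ) :
    degenerate X (n + 1) →ₗ[ℤ] degenerate X n :=
  (boundary X n).restrict (boundary_degenerate X n)

theorem degenerateBoundary_comp (X : Type u) [Quandle X] (n : ℕ) :
    degenerateBoundary X n ∘ₗ degenerateBoundary X (n + 1) = 0 := by
  ext1 c
  exact Subtype.ext (LinearMap.congr_fun (boundary_comp X n) c.1)

/-- The complex `Cᴰ(X)` of degenerate chains, a subcomplex of the rack complex. -/
def degenerateComplex (X : Type u) [Quandle X] : ChainComplex (ModuleCat.{u} ℤ) ℕ :=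
  ChainComplex.of (fun n => ModuleCat.of ℤ (degenerate X n))
    (fun n => ModuleCat.ofHom (degenerateBoundary X n))
    (fun n => by rw [← ModuleCat.ofHom_comp, degenerateBoundary_comp]; rfl)

/-- The boundary induced on `Cᴿ(X) / Cᴰ(X)`. -/
def quandleBoundary (X : Type u) [Quandle X] (n : ℕ) :
    (RackChain X (n + 1) ⧸ degenerate X (n + 1)) →ₗ[ℤ] (RackChain X n ⧸ degenerate X n) :=
  (degenerate X (n + 1)).mapQ (degenerate X n) (boundary X n) (boundary_degenerate X n)

theorem quandleBoundary_comp (X : Type u) [Quandle X] (n : ℕ) :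
    quandleBoundary X n ∘ₗ quandleBoundary X (n + 1) = 0 := by
  refine Submodule.linearMap_qext _ (LinearMap.ext fun c => ?_)
  have := LinearMap.congr_fun (boundary_comp X n) c
  simp only [LinearMap.comp_apply, LinearMap.zero_apply] at this
  simp [quandleBoundary, this]

/-- The quandle complex `C^Q(X) = Cᴿ(X) / Cᴰ(X)`. -/
def quandleComplex (X : Type u) [Quandle X] : ChainComplex (ModuleCat.{u} ℤ) ℕ :=
  ChainComplex.of (fun n => ModuleCat.of ℤ (RackChain X n ⧸ degenerate X n))
    (fun n => ModuleCat.ofHom (quandleBoundary X n))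
    (fun n => by rw [← ModuleCat.ofHom_comp, quandleBoundary_comp]; rfl)

/-- The three homology theories: rack (`R`), degenerate (`D`), quandle (`Q`). -/
inductive Theory : Type
  | R
  | D
  | Q

/-- The chain complex of the theory `W`. -/
def complex (W : Theory) (X : Type u) [Quandle X] : ChainComplex (ModuleCat.{u} ℤ) ℕ :=
  match W with
  | Theory.R => rackComplex X
  | Theory.D => degenerateComplex X
  | Theory.Q => quandleComplex X

/-- The homology group `Hₙᵂ(X)` with integral coefficients. -/
abbrev H (W : Theory) (n : ℕ) (X : Type u) [Quandle X] : Type u :=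
  (complex W X).homology n

/-- The torsion subgroup of `Hₙᵂ(X)`. -/
abbrev torH (W : Theory) (n : ℕ) (X : Type u) [Quandle X] : AddSubgroup (H W n X) :=
  AddCommGroup.torsion (H W n X)

end QuandleHomology

end

/-! Homology is functorial for maps of rack chains that commute with the boundary and preserve
degenerate chains, and all three theories are treated at once through `ChainHom`.

Parts (i) and (ii) are splitting arguments (`exists_injective_of_retractions`). By the Chinese
remainder theorem R_{mk} is the product of R_m and R_k, so each factor is a retract. The cross
composites are constant, hence factor through R_1, whose homology is torsion-free because its
boundary vanishes; they therefore kill torsion (`homology_comp_eq_zero_of_torsion`). For R_{2k} both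
copies of R_k project identically to R_k, but they lie in different orbits. The boundary preserves
the orbit of the first entry, so chains can be cut down to one orbit before projecting, and this
separates the copies (`orbitProj_inclRight`).

Part (iii) reduces to R_p by the same retraction. In degree 3 the cycle ∑ᵢ (r, i, i + 1) becomes
null after multiplication by p² (`nsmul_shadowCycle_mem`), while Mochizuki's cocycle takes the value
-1 mod p on it (`cochain3_shadowCycle`). So its class has finite order divisible by p, and a
multiple of it generates a copy of ℤ_p. In degree 4 the cycle is transported by w ↦ (w + w * y, y),
and the cocycle by composition with the alternating sum of the faces ∂⁰ᵢ; the value becomes -2,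
nonzero since p is odd. -/

noncomputable section

namespace QuandleHomology

universe u

open CategoryTheory

/-! ### Torsion and elements of prime order in the homology of a complex -/

section Homology

theorem homologyMap_eq_zero {C D : ChainComplex (ModuleCat.{u} ℤ) ℕ} (f : C ⟶ D) (n : ℕ)
    (h : f.f n = 0) : HomologicalComplex.homologyMap f n = 0 := by
  have h1 : HomologicalComplex.cyclesMap f n = 0 := by
    rw [← cancel_mono (D.iCycles n), HomologicalComplex.cyclesMap_i, h]
    simp
  rw [← cancel_epi (C.homologyπ n), HomologicalComplex.homologyπ_naturality, h1]
  simp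

/-- With no nonzero boundaries in degree n, the homology is the group of cycles, which sits inside
the torsion-free chain group. -/
theorem homology_torsionFree (C : ChainComplex (ModuleCat.{u} ℤ) ℕ) (n : ℕ)
    (hd : C.d (n + 1) n = 0) (hC : ∀ (N : ℕ) (c : C.X n), 0 < N → N • c = 0 → c = 0)
    {N : ℕ} (hN : 0 < N) (h : C.homology n) (hh : N • h = 0) : h = 0 := by
  have := C.isIso_homologyπ (n + 1) n (by simp) hd
  obtain ⟨z, rfl⟩ := (ConcreteCategory.bijective_of_isIso (C.homologyπ n)).2 h
  rw [← map_nsmul] at hh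
  have hz : N • z = 0 :=
    (ConcreteCategory.bijective_of_isIso (C.homologyπ n)).1 (by rw [hh, map_zero])
  have hi : C.iCycles n z = 0 := hC N _ hN (by rw [← map_nsmul, hz, map_zero])
  have : z = 0 := (ModuleCat.mono_iff_injective (C.iCycles n)).1 inferInstance
    (by rw [hi, map_zero])
  rw [this, map_zero]

/-- The categorical cycles are known by a universal property only, so the element is obtained by
lifting the map from ℤ that sends 1 to `c`. -/
theorem exists_cycle (C : ChainComplex (ModuleCat.{u} ℤ) ℕ) (n : ℕ) (c : C.X (n + 1))
    (hc : C.d (n + 1) n c = 0) : ∃ z : C.cycles (n + 1), C.iCycles (n + 1) z = c := by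
  let k : ModuleCat.of ℤ (ULift.{u} ℤ) ⟶ C.X (n + 1) :=
    ModuleCat.ofHom ((LinearMap.toSpanSingleton ℤ _ c) ∘ₗ ULift.moduleEquiv.toLinearMap)
  have hk : k ≫ C.d (n + 1) n = 0 := by
    ext
    simp [k, hc]
  refine ⟨C.liftCycles k n (by simp) hk (ULift.up 1), ?_⟩
  rw [← ConcreteCategory.comp_apply, HomologicalComplex.liftCycles_i]
  exact LinearMap.toSpanSingleton_apply_one ℤ _ c

/-- The order of `h` annihilates `θ h`, a nonzero element of a field of characteristic p, so p
divides it; writing the order as p * q, the element `q • h` has order p. -/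
theorem exists_zmod_injective {A : Type*} [AddCommGroup A] {p N : ℕ} [Fact p.Prime] (hN : 0 < N)
    (h : A) (hh : N • h = 0) (θ : A →+ ZMod p) (hθ : θ h ≠ 0) :
    ∃ f : ZMod p →+ A, Function.Injective f := by
  have hfin : 0 < addOrderOf h :=
    addOrderOf_pos_iff.2 (isOfFinAddOrder_iff_nsmul_eq_zero.2 ⟨N, hN, hh⟩)
  have hdvd : p ∣ addOrderOf h := by
    rw [← ZMod.natCast_eq_zero_iff]
    have := congrArg θ (addOrderOf_nsmul_eq_zero h)
    rw [map_nsmul, map_zero, nsmul_eq_mul] at this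
    exact (mul_eq_zero.1 this).resolve_right hθ
  obtain ⟨q, hq⟩ := hdvd
  have hq0 : q ≠ 0 := by rintro rfl; rw [mul_zero] at hq; omega
  have ho : addOrderOf (q • h) = p := by
    rw [addOrderOf_nsmul' _ hq0, hq, Nat.gcd_eq_right (Dvd.intro_left p rfl),
      Nat.mul_div_cancel _ (Nat.pos_of_ne_zero hq0)]
  refine ⟨ZMod.lift p ⟨zmultiplesHom A (q • h), ?_⟩, ?_⟩
  · simpa [ho] using addOrderOf_nsmul_eq_zero (q • h)
  · refine (ZMod.lift_injective _).2 fun m hm => ?_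
    rw [ZMod.intCast_zmod_eq_zero_iff_dvd]
    have : m • (q • h) = 0 := by simpa using hm
    rw [← ho]
    exact addOrderOf_dvd_iff_zsmul_eq_zero.2 this

/-- The cocycle `θ` descends to homology, where it detects the class of `c`; the chain `d` witnesses
that N times this class is zero. -/
theorem exists_zmod_injective_homology (C : ChainComplex (ModuleCat.{0} ℤ) ℕ) (n : ℕ)
    {p N : ℕ} [Fact p.Prime] (hN : 0 < N) (c : C.X (n + 1)) (hc : C.d (n + 1) n c = 0)
    (d : C.X (n + 2)) (hd : C.d (n + 2) (n + 1) d = N • c)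
    (θ : C.X (n + 1) →ₗ[ℤ] ZMod p) (hθ : ∀ e, θ (C.d (n + 2) (n + 1) e) = 0)
    (hne : θ c ≠ 0) :
    ∃ f : ZMod p →+ C.homology (n + 1), Function.Injective f := by
  obtain ⟨z, hz⟩ := exists_cycle C n c hc
  let k : C.X (n + 1) ⟶ ModuleCat.of ℤ (ZMod p) := ModuleCat.ofHom θ
  have hk : C.d (n + 2) (n + 1) ≫ k = 0 := by
    ext e
    exact hθ e
  let Θ := C.homologyι (n + 1) ≫ C.descOpcycles k (n + 2) (by simp) hk
  have hcomp : C.homologyπ (n + 1) ≫ Θ = C.iCycles (n + 1) ≫ k := by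
    simp [Θ]
  refine exists_zmod_injective hN (C.homologyπ (n + 1) z) ?_ Θ.hom.toAddMonoidHom ?_
  · have hNz : N • z = C.toCycles (n + 2) (n + 1) d := by
      apply (ModuleCat.mono_iff_injective (C.iCycles (n + 1))).1 inferInstance
      rw [map_nsmul, hz, ← hd, ← ConcreteCategory.comp_apply, HomologicalComplex.toCycles_i]
    rw [← map_nsmul, hNz, ← ConcreteCategory.comp_apply,
      HomologicalComplex.toCycles_comp_homologyπ]
    rfl
  · have : Θ (C.homologyπ (n + 1) z) = k (C.iCycles (n + 1) z) := by
      rw [← ConcreteCategory.comp_apply, hcomp, ConcreteCategory.comp_apply]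
    rw [hz] at this
    exact fun h0 => hne (this.symm.trans h0)

end Homology

/-! ### Chain maps and the maps they induce in the three theories -/

/-- A family of linear maps between rack chains that is compatible with the boundary and with the
degenerate chains. -/
@[ext]
structure ChainHom (X Y : Type u) [Quandle X] [Quandle Y] where
  f : ∀ n, RackChain X n →ₗ[ℤ] RackChain Y n
  comm : ∀ n c, f n (boundary X n c) = boundary Y n (f (n + 1) c)
  deg : ∀ n, degenerate X n ≤ (degenerate Y n).comap (f n)

namespace ChainHom

variable {X Y Z : Type u} [Quandle X] [Quandle Y] [Quandle Z]

/-- Composition of chain homomorphisms. -/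
def comp (g : ChainHom Y Z) (f : ChainHom X Y) : ChainHom X Z where
  f n := g.f n ∘ₗ f.f n
  comm n c := by simp [f.comm, g.comm]
  deg n := fun c hc => g.deg n (f.deg n hc)

/-- The maps induced on the chain groups of the theory `W`. -/
def component (φ : ChainHom X Y) :
    ∀ (W : Theory) (n : ℕ), (complex W X).X n ⟶ (complex W Y).X n
  | Theory.R, n => ModuleCat.ofHom (φ.f n)
  | Theory.D, n => ModuleCat.ofHom ((φ.f n).restrict (φ.deg n))
  | Theory.Q, n => ModuleCat.ofHom ((degenerate X n).mapQ (degenerate Y n) (φ.f n) (φ.deg n))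

/-- The chain map induced on the complex of the theory `W`. -/
def map (φ : ChainHom X Y) (W : Theory) : complex W X ⟶ complex W Y :=
  ChainComplex.ofHom (φ.component W) fun n => by
    cases W
    · simp only [complex, rackComplex, ChainComplex.of_d]
      ext1
      exact LinearMap.ext fun c => (φ.comm n c).symm
    · simp only [complex, degenerateComplex, ChainComplex.of_d]
      ext1
      exact LinearMap.ext fun c => Subtype.ext (φ.comm n c.1).symm
    · simp only [complex, quandleComplex, ChainComplex.of_d]
      ext1
      refine Submodule.linearMap_qext _ (LinearMap.ext fun c => ?_)
      exact congrArg (Submodule.Quotient.mk (p := degenerate Y n)) (φ.comm n c).symm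

theorem map_comp (g : ChainHom Y Z) (f : ChainHom X Y) (W : Theory) :
    (g.comp f).map W = f.map W ≫ g.map W := by
  ext1 n
  cases W
  · rfl
  · rfl
  · refine ModuleCat.hom_ext (Submodule.linearMap_qext _ (LinearMap.ext fun c => rfl))

theorem map_f_eq_id (φ : ChainHom X X) (n : ℕ) (h : φ.f n = LinearMap.id) (W : Theory) :
    (φ.map W).f n = 𝟙 _ := by
  cases W
  · exact ModuleCat.hom_ext h
  · exact ModuleCat.hom_ext (LinearMap.ext fun c => Subtype.ext (LinearMap.congr_fun h c.1))
  · exact ModuleCat.hom_ext (Submodule.linearMap_qext _ (LinearMap.ext fun c =>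
      congrArg (Submodule.Quotient.mk (p := degenerate X n)) (LinearMap.congr_fun h c)))

theorem map_f_eq_zero (φ : ChainHom X Y) (n : ℕ) (h : φ.f n = 0) (W : Theory) :
    (φ.map W).f n = 0 := by
  cases W
  · exact ModuleCat.hom_ext h
  · exact ModuleCat.hom_ext (LinearMap.ext fun c => Subtype.ext (LinearMap.congr_fun h c.1))
  · exact ModuleCat.hom_ext (Submodule.linearMap_qext _ (LinearMap.ext fun c =>
      congrArg (Submodule.Quotient.mk (p := degenerate Y n)) (LinearMap.congr_fun h c)))

/-- The map induced on homology. -/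
def homology (φ : ChainHom X Y) (W : Theory) (n : ℕ) : H W n X →+ H W n Y :=
  (HomologicalComplex.homologyMap (φ.map W) n).hom.toAddMonoidHom

theorem homology_comp (g : ChainHom Y Z) (f : ChainHom X Y) (W : Theory) (n : ℕ) (h : H W n X) :
    (g.comp f).homology W n h = g.homology W n (f.homology W n h) := by
  simp only [homology, map_comp, HomologicalComplex.homologyMap_comp]
  rfl

theorem homology_eq_self (φ : ChainHom X X) (n : ℕ) (hφ : φ.f n = LinearMap.id) (W : Theory)
    (h : H W n X) : φ.homology W n h = h := by
  have hc : HomologicalComplex.cyclesMap (φ.map W) n = 𝟙 _ := by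
    rw [← cancel_mono ((complex W X).iCycles n), HomologicalComplex.cyclesMap_i,
      φ.map_f_eq_id n hφ]
    simp
  have : HomologicalComplex.homologyMap (φ.map W) n = 𝟙 _ := by
    rw [← cancel_epi ((complex W X).homologyπ n), HomologicalComplex.homologyπ_naturality, hc]
    simp
  simp only [homology, this]
  rfl

/-- The hypothesis concerns degree n alone. This matters for the orbit projections, whose cross
composites vanish in positive degrees but are the identity in degree 0. -/
theorem homology_eq_zero (φ : ChainHom X Y) (n : ℕ) (hφ : φ.f n = 0) (W : Theory)
    (h : H W n X) : φ.homology W n h = 0 := by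
  simp only [homology, homologyMap_eq_zero _ n (φ.map_f_eq_zero n hφ W)]
  rfl

end ChainHom

/-! ### Vanishing boundaries and torsion-freeness -/

theorem boundary_single (X : Type u) [Shelf X] (n : ℕ) (x : Fin (n + 1) → X) (c : ℤ) :
    boundary X n (Finsupp.single x c) = ∑ i : Fin (n + 1), (-1 : ℤ) ^ (i.val + 1) •
      (Finsupp.single (face0 i x) c - Finsupp.single (face1 i x) c) := by
  simp [boundary, faceDiff_single, LinearMap.sum_apply]

theorem boundary_eq_zero (X : Type u) [Shelf X] (n : ℕ)
    (h : ∀ (i : Fin (n + 1)) (x : Fin (n + 1) → X), face0 i x = face1 i x) :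
    boundary X n = 0 := by
  refine Finsupp.lhom_ext fun x c => ?_
  simp [boundary_single, h]

theorem boundary_zero (X : Type u) [Shelf X] : boundary X 0 = 0 :=
  boundary_eq_zero X 0 fun _ _ => Subsingleton.elim _ _

/-- Degenerate chains are spanned by part of the basis, so membership is tested coefficient by
coefficient; hence the quotient by them has no torsion. -/
theorem degenerate_eq_supported (X : Type u) (n : ℕ) :
    degenerate X n = Finsupp.supported ℤ ℤ {x : Fin n → X | IsDegenerate x} := by
  rw [Finsupp.supported_eq_span_single, degenerate]
  congr 1
  ext c
  exact ⟨fun ⟨x, h, e⟩ => ⟨x, h, e.symm⟩, fun ⟨x, h, e⟩ => ⟨x, h, e.symm⟩⟩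

theorem rackChain_eq_zero_of_nsmul {X : Type u} {n N : ℕ} (hN : 0 < N) {c : RackChain X n}
    (h : N • c = 0) : c = 0 :=
  Finsupp.ext fun x => (smul_eq_zero.1 (DFunLike.congr_fun h x)).resolve_left hN.ne'

theorem mem_degenerate_of_nsmul {X : Type u} {n N : ℕ} (hN : 0 < N) {c : RackChain X n}
    (h : N • c ∈ degenerate X n) : c ∈ degenerate X n := by
  rw [degenerate_eq_supported, Finsupp.mem_supported'] at h ⊢
  intro x hx
  have := h x hx
  rw [Finsupp.smul_apply, smul_eq_zero] at this
  exact this.resolve_left hN.ne'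

/-- If the incoming boundary vanishes then the homology of the theory `W` is torsion-free. -/
theorem H_torsionFree (X : Type u) [Quandle X] (n : ℕ) (hb : boundary X n = 0) (W : Theory)
    (h : H W n X) (hh : h ∈ torH W n X) : h = 0 := by
  obtain ⟨N, hN, hNh⟩ := isOfFinAddOrder_iff_nsmul_eq_zero.1 hh
  refine homology_torsionFree (complex W X) n ?_ ?_ hN h hNh
  · cases W
    · simp only [complex, rackComplex, ChainComplex.of_d]
      exact ModuleCat.hom_ext hb
    · simp only [complex, degenerateComplex, ChainComplex.of_d]
      exact ModuleCat.hom_ext (LinearMap.ext fun c => Subtype.ext (LinearMap.congr_fun hb c.1))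
    · simp only [complex, quandleComplex, ChainComplex.of_d]
      exact ModuleCat.hom_ext (Submodule.linearMap_qext _ (LinearMap.ext fun c =>
        congrArg (Submodule.Quotient.mk (p := degenerate X n)) (LinearMap.congr_fun hb c)))
  · intro N c hN hc
    cases W
    · exact rackChain_eq_zero_of_nsmul hN hc
    · exact Subtype.ext (rackChain_eq_zero_of_nsmul hN (congrArg Subtype.val hc))
    · change RackChain X n ⧸ degenerate X n at c
      obtain ⟨c, rfl⟩ := Submodule.Quotient.mk_surjective _ c
      refine (Submodule.Quotient.mk_eq_zero _).2 (mem_degenerate_of_nsmul hN ?_)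
      exact (Submodule.Quotient.mk_eq_zero _).1 hc

/-! ### Chain maps from quandle homomorphisms and from unions of orbits -/

theorem face0_zero_eq_face1_zero {X : Type u} [Shelf X] {n : ℕ} (x : Fin (n + 1) → X) :
    face0 0 x = face1 0 x := by
  funext j
  simp [face0, face1]

/-- Restriction of chains to the tuples whose first entry lies in `P`. -/
def firstEntryComponent {X : Type u} (P : X → Prop) [DecidablePred P] :
    ∀ n, RackChain X n →ₗ[ℤ] RackChain X n
  -- The empty tuple has no first entry; the identity is a harmless choice since the boundary into
  -- degree 0 vanishes.
  | 0 => LinearMap.id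
  | _ + 1 => Finsupp.lsum ℤ fun x => if P (x 0) then Finsupp.lsingle x else 0

theorem firstEntryComponent_single {X : Type u} (P : X → Prop) [DecidablePred P] (n : ℕ)
    (x : Fin (n + 1) → X) (c : ℤ) : firstEntryComponent P (n + 1) (Finsupp.single x c) =
      if P (x 0) then Finsupp.single x c else 0 := by
  simp only [firstEntryComponent, Finsupp.lsum_single]
  split_ifs <;> simp

namespace ChainHom

variable {X Y : Type u} [Quandle X] [Quandle Y]

/-- The chain homomorphism induced by a homomorphism of quandles. -/
def ofHom (f : ShelfHom X Y) : ChainHom X Y where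
  f n := Finsupp.lmapDomain ℤ ℤ (fun x : Fin n → X => f ∘ x)
  comm n c := by
    induction c using Finsupp.induction_linear with
    | zero => simp
    | add c d hc hd => simp only [map_add, hc, hd]
    | single x c =>
      have h0 : ∀ i, f ∘ face0 i x = face0 i (f ∘ x) := fun i => rfl
      have h1 : ∀ i, f ∘ face1 i x = face1 i (f ∘ x) := fun i => by
        funext j
        simp only [face1, Function.comp_apply, op]
        split_ifs
        · exact f.map_act
        · rfl
      simp only [boundary_single, map_sum, map_smul, map_sub, Finsupp.lmapDomain_apply,
        Finsupp.mapDomain_single, h0, h1]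
  deg n := by
    refine Submodule.span_le.2 ?_
    rintro _ ⟨x, ⟨i, j, hij, h⟩, rfl⟩
    refine Submodule.subset_span ⟨f ∘ x, ⟨i, j, hij, congrArg f h⟩, ?_⟩
    simp [Finsupp.mapDomain_single]

theorem ofHom_f_single (f : ShelfHom X Y) (n : ℕ) (x : Fin n → X) (c : ℤ) :
    (ofHom f).f n (Finsupp.single x c) = Finsupp.single (f ∘ x) c := by
  simp [ofHom, Finsupp.mapDomain_single]

/-- If `P` is a union of orbits then the restriction of chains to the tuples whose first entry
lies in `P` is compatible with the boundary. -/
def restrictFirst (P : X → Prop) [DecidablePred P] (hP : ∀ x y : X, P (op x y) ↔ P x) :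
    ChainHom X X where
  f := firstEntryComponent P
  comm n c := by
    cases n with
    | zero => simp [boundary_zero]
    | succ n =>
      induction c using Finsupp.induction_linear with
      | zero => simp
      | add c d hc hd => simp only [map_add, hc, hd]
      | single x c =>
        have key : ∀ i : Fin (n + 2), firstEntryComponent P (n + 1)
            (Finsupp.single (face0 i x) c - Finsupp.single (face1 i x) c) =
            if P (x 0) then Finsupp.single (face0 i x) c - Finsupp.single (face1 i x) c else 0 := by
          intro i
          rcases Fin.eq_zero_or_eq_succ i with rfl | ⟨i, rfl⟩
          -- Removing the first entry may change the orbit, but the two faces at this index cancel.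
          · simp [face0_zero_eq_face1_zero]
          · have h0 : face0 i.succ x 0 = x 0 := rfl
            have h1 : P (face1 i.succ x 0) ↔ P (x 0) := by
              have : face1 i.succ x 0 = op (x 0) (x i.succ) := by
                simp [face1]
              rw [this, hP]
            rw [map_sub, firstEntryComponent_single, firstEntryComponent_single, h0]
            simp only [h1]
            split_ifs <;> simp
        rw [firstEntryComponent_single, boundary_single, map_sum]
        simp only [map_smul, key]
        split_ifs
        · rw [boundary_single]
        · simp
  deg n := by
    cases n with
    | zero => exact fun c hc => hc
    | succ n =>
      refine Submodule.span_le.2 ?_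
      rintro _ ⟨x, hx, rfl⟩
      simp only [SetLike.mem_coe, Submodule.mem_comap, firstEntryComponent_single]
      split_ifs
      · exact Submodule.subset_span ⟨x, hx, rfl⟩
      · exact Submodule.zero_mem _

end ChainHom

open ChainHom

/-! ### Affine maps of dihedral quandles and retractions -/

/-- An affine map between cyclic groups is a homomorphism of dihedral quandles. -/
def affineHom {a b : ℕ} (f : ZMod a →+ ZMod b) (s : ZMod b) :
    ShelfHom (Quandle.Dihedral a) (Quandle.Dihedral b) where
  toFun := fun x => (f x + s : ZMod b)
  map_act' := by
    have key : ∀ x y : ZMod a, f (2 * x - y) + s = 2 * (f x + s) - (f y + s) := by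
      intro x y
      rw [map_sub, two_mul, map_add]
      ring
    exact fun {x y} => key x y

theorem ofHom_comp {X Y Z : Type} [Quandle X] [Quandle Y] [Quandle Z] (g : ShelfHom Y Z)
    (f : ShelfHom X Y) (e : ShelfHom X Z) (h : ∀ x, g (f x) = e x) :
    (ofHom g).comp (ofHom f) = ofHom e := by
  refine ChainHom.ext (funext fun n => Finsupp.lhom_ext fun x c => ?_)
  simp only [comp, LinearMap.comp_apply, ofHom_f_single]
  congr 1
  exact funext fun j => h _

instance : Subsingleton (Quandle.Dihedral 1) := inferInstanceAs (Subsingleton (ZMod 1))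

/-- The homomorphism induced by a constant map kills the torsion of the homology. -/
theorem homology_comp_eq_zero_of_torsion {Y : Type} [Quandle Y] {a b : ℕ} {s : ZMod b}
    (g : ShelfHom Y (Quandle.Dihedral b)) (f : ShelfHom (Quandle.Dihedral a) Y)
    (hf : ∀ x, g (f x) = s) (W : Theory) (n : ℕ) (h : H W n (Quandle.Dihedral a))
    (hh : h ∈ torH W n (Quandle.Dihedral a)) :
    (ofHom g).homology W n ((ofHom f).homology W n h) = 0 := by
  -- A constant map factors through R_1, where all faces coincide and the boundary is zero.
  have hfac : (ofHom g).comp (ofHom f) =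
      (ofHom (affineHom (0 : ZMod 1 →+ ZMod b) s)).comp
        (ofHom (affineHom (0 : ZMod a →+ ZMod 1) 0)) := by
    rw [ofHom_comp g f (affineHom 0 s) fun x => (hf x).trans (zero_add s).symm,
      ofHom_comp _ _ (affineHom 0 s) fun x => rfl]
  have h0 : (ofHom (affineHom (0 : ZMod a →+ ZMod 1) 0)).homology W n h = 0 :=
    H_torsionFree (Quandle.Dihedral 1) n
      (boundary_eq_zero _ n fun _ _ => Subsingleton.elim _ _) W _
      (AddMonoidHom.isOfFinAddOrder _ hh)
  rw [← homology_comp, hfac, homology_comp, h0, map_zero]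

theorem homology_ofHom_leftInverse {X Y : Type} [Quandle X] [Quandle Y] (p : ShelfHom Y X)
    (i : ShelfHom X Y) (h : ∀ x, p (i x) = x) (W : Theory) (n : ℕ) (c : H W n X) :
    (ofHom p).homology W n ((ofHom i).homology W n c) = c := by
  rw [← homology_comp]
  refine homology_eq_self _ n (Finsupp.lhom_ext fun x c => ?_) W c
  simp only [comp, LinearMap.comp_apply, ofHom_f_single, LinearMap.id_apply]
  congr 1
  funext j
  exact h _

/-- Two additive homomorphisms into a common group whose sum is injective because of a system of
retractions. -/
theorem exists_injective_of_retractions {A B C : Type*} [AddCommGroup A] [AddCommGroup B]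
    [AddCommGroup C] (S : AddSubgroup A) (T : AddSubgroup B) (i : A →+ C) (j : B →+ C)
    (p : C →+ A) (q : C →+ B) (hpi : ∀ a ∈ S, p (i a) = a) (hpj : ∀ b ∈ T, p (j b) = 0)
    (hqi : ∀ a ∈ S, q (i a) = 0) (hqj : ∀ b ∈ T, q (j b) = b) :
    ∃ f : S × T →+ C, Function.Injective f := by
  refine ⟨(i.comp S.subtype).coprod (j.comp T.subtype), ?_⟩
  rw [injective_iff_map_eq_zero]
  rintro ⟨⟨a, ha⟩, ⟨b, hb⟩⟩ h
  have h' : i a + j b = 0 := h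
  have h1 := congrArg p h'
  have h2 := congrArg q h'
  rw [map_add, map_zero, hpi a ha, hpj b hb, add_zero] at h1
  rw [map_add, map_zero, hqi a ha, hqj b hb, zero_add] at h2
  subst h1 h2
  rfl

/-! ### The product decomposition for coprime factors -/

section Coprime

variable {m k : ℕ}

/-- The projection `R_{mk} → R_m`. -/
def projLeft (h : Nat.Coprime m k) : ShelfHom (Quandle.Dihedral (m * k)) (Quandle.Dihedral m) :=
  affineHom ((AddMonoidHom.fst _ _).comp (ZMod.chineseRemainder h).toAddEquiv.toAddMonoidHom) 0

/-- The projection `R_{mk} → R_k`. -/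
def projRight (h : Nat.Coprime m k) : ShelfHom (Quandle.Dihedral (m * k)) (Quandle.Dihedral k) :=
  affineHom ((AddMonoidHom.snd _ _).comp (ZMod.chineseRemainder h).toAddEquiv.toAddMonoidHom) 0

/-- The inclusion `x ↦ (x, 0)` of `R_m` in `R_{mk}`. -/
def inclLeft (h : Nat.Coprime m k) : ShelfHom (Quandle.Dihedral m) (Quandle.Dihedral (m * k)) :=
  affineHom ((ZMod.chineseRemainder h).symm.toAddEquiv.toAddMonoidHom.comp
    (AddMonoidHom.inl _ _)) 0

/-- The inclusion `x ↦ (s, x)` of `R_k` in `R_{mk}`. -/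
def inclRight (h : Nat.Coprime m k) (s : ZMod m) :
    ShelfHom (Quandle.Dihedral k) (Quandle.Dihedral (m * k)) :=
  affineHom ((ZMod.chineseRemainder h).symm.toAddEquiv.toAddMonoidHom.comp
    (AddMonoidHom.inr _ _)) ((ZMod.chineseRemainder h).symm (s, 0))

theorem projLeft_inclLeft (h : Nat.Coprime m k) (x : Quandle.Dihedral m) :
    projLeft h (inclLeft h x) = x := by
  have key (x : ZMod m) :
      (ZMod.chineseRemainder h ((ZMod.chineseRemainder h).symm (x, 0) + 0)).1 + 0 = x := by simp
  exact key x

theorem projRight_inclLeft (h : Nat.Coprime m k) (x : Quandle.Dihedral m) :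
    projRight h (inclLeft h x) = (0 : ZMod k) := by
  change (ZMod.chineseRemainder h
    ((ZMod.chineseRemainder h).symm ((x : ZMod m), (0 : ZMod k)) + 0)).2 + 0 = (0 : ZMod k)
  simp

theorem projLeft_inclRight (h : Nat.Coprime m k) (s : ZMod m) (x : Quandle.Dihedral k) :
    projLeft h (inclRight h s x) = s := by
  change (ZMod.chineseRemainder h ((ZMod.chineseRemainder h).symm ((0 : ZMod m), (x : ZMod k)) +
    (ZMod.chineseRemainder h).symm (s, 0))).1 + 0 = s
  simp

theorem projRight_inclRight (h : Nat.Coprime m k) (s : ZMod m) (x : Quandle.Dihedral k) :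
    projRight h (inclRight h s x) = x := by
  have key (x : ZMod k) : (ZMod.chineseRemainder h ((ZMod.chineseRemainder h).symm (0, x) +
      (ZMod.chineseRemainder h).symm (s, 0))).2 + 0 = x := by simp
  exact key x

theorem exists_injective_torH_prod (h : Nat.Coprime m k) (W : Theory) (n : ℕ) :
    ∃ f : torH W n (Quandle.Dihedral m) × torH W n (Quandle.Dihedral k) →+
      H W n (Quandle.Dihedral (m * k)), Function.Injective f :=
  exists_injective_of_retractions _ _ ((ofHom (inclLeft h)).homology W n)
    ((ofHom (inclRight h 0)).homology W n) ((ofHom (projLeft h)).homology W n)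
    ((ofHom (projRight h)).homology W n)
    (fun a _ => homology_ofHom_leftInverse _ _ (projLeft_inclLeft h) W n a)
    (fun b hb => homology_comp_eq_zero_of_torsion _ _ (projLeft_inclRight h 0) W n b hb)
    (fun a ha => homology_comp_eq_zero_of_torsion _ _ (projRight_inclLeft h) W n a ha)
    (fun b _ => homology_ofHom_leftInverse _ _ (projRight_inclRight h 0) W n b)

end Coprime

/-! ### The two orbits of R_{2k} -/

section Two

variable {k : ℕ}

/-- The operation of R_2 is trivial, since 2b - a = a modulo 2, so parity is constant on orbits. -/
theorem projLeft_op (h : Nat.Coprime 2 k) (s : ZMod 2) (x y : Quandle.Dihedral (2 * k)) :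
    (projLeft h (op x y) : ZMod 2) = s ↔ (projLeft h x : ZMod 2) = s := by
  have key : ∀ s a b : ZMod 2, 2 * b - a = s ↔ a = s := by decide
  have : projLeft h (op x y) = op (projLeft h x) (projLeft h y) := (projLeft h).map_act
  rw [this]
  exact key s _ _

instance (a b : ℕ) (f : Quandle.Dihedral a → Quandle.Dihedral b) (s : ZMod b) :
    DecidablePred fun x => (f x : ZMod b) = s :=
  fun x => inferInstanceAs (Decidable ((show ZMod b from f x) = s))

/-- The chain homomorphism which projects the tuples with first entry in the orbit of parity `s`
to `R_k`, and kills the other tuples. -/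
def orbitProj (h : Nat.Coprime 2 k) (s : ZMod 2) :
    ChainHom (Quandle.Dihedral (2 * k)) (Quandle.Dihedral k) :=
  (ofHom (projRight h)).comp
    (restrictFirst (fun x => (projLeft h x : ZMod 2) = s) (projLeft_op h s))

/-- The inclusion with parameter `t` lands in the orbit of parity `t`, so the restriction keeps
everything or kills everything. A first entry is needed, hence the positive degree. -/
theorem orbitProj_inclRight (h : Nat.Coprime 2 k) (s t : ZMod 2) (n : ℕ)
    (x : Fin (n + 1) → Quandle.Dihedral k) (c : ℤ) :
    ((orbitProj h s).comp (ofHom (inclRight h t))).f (n + 1) (Finsupp.single x c) =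
      if t = s then Finsupp.single x c else 0 := by
  have hx : projRight h ∘ inclRight h t ∘ x = x := funext fun j => projRight_inclRight h t _
  simp only [orbitProj, comp, restrictFirst, LinearMap.comp_apply, ofHom_f_single,
    firstEntryComponent_single, Function.comp_apply]
  have he : (projLeft h (inclRight h t (x 0)) : ZMod 2) = s ↔ t = s :=
    Eq.congr_left (projLeft_inclRight h t (x 0))
  simp only [he]
  split_ifs
  · rw [ofHom_f_single, hx]
  · simp

theorem exists_injective_torH_prod_self (h : Nat.Coprime 2 k) (W : Theory) (n : ℕ) :
    ∃ f : torH W n (Quandle.Dihedral k) × torH W n (Quandle.Dihedral k) →+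
      H W n (Quandle.Dihedral (2 * k)), Function.Injective f := by
  cases n with
  | zero =>
    -- In degree 0 the orbits cannot be told apart, but there is no torsion and zero maps suffice.
    have h0 := H_torsionFree (Quandle.Dihedral k) 0 (boundary_zero _) W
    exact exists_injective_of_retractions _ _ 0 0 0 0 (fun a ha => (h0 a ha).symm)
      (fun _ _ => rfl) (fun _ _ => rfl) (fun a ha => (h0 a ha).symm)
  | succ n =>
    have hself : ∀ s a, (orbitProj h s).homology W (n + 1)
        ((ofHom (inclRight h s)).homology W (n + 1) a) = a := by
      intro s a
      rw [← homology_comp]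
      refine homology_eq_self _ _ (Finsupp.lhom_ext fun x c => ?_) W a
      rw [orbitProj_inclRight, if_pos rfl, LinearMap.id_apply]
    have hne : ∀ s t a, t ≠ s → (orbitProj h s).homology W (n + 1)
        ((ofHom (inclRight h t)).homology W (n + 1) a) = 0 := by
      intro s t a hst
      rw [← homology_comp]
      refine homology_eq_zero _ _ (Finsupp.lhom_ext fun x c => ?_) W a
      rw [orbitProj_inclRight, if_neg hst, LinearMap.zero_apply]
    exact exists_injective_of_retractions _ _ ((ofHom (inclRight h 0)).homology W (n + 1))
      ((ofHom (inclRight h 1)).homology W (n + 1)) ((orbitProj h 0).homology W (n + 1))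
      ((orbitProj h 1).homology W (n + 1)) (fun a _ => hself 0 a)
      (fun a _ => hne 0 1 a (by decide)) (fun a _ => hne 1 0 a (by decide)) (fun a _ => hself 1 a)

end Two

/-! ### Detecting ℤ_p in quandle homology by explicit rack chains -/

/-- The chains which represent zero in the degree `n` quandle homology. -/
def nullChains (X : Type u) [Quandle X] (n : ℕ) : Submodule ℤ (RackChain X n) :=
  LinearMap.range (boundary X n) ⊔ degenerate X n

theorem boundary_mem_nullChains {X : Type u} [Quandle X] {n : ℕ} (d : RackChain X (n + 1)) :
    boundary X n d ∈ nullChains X n :=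
  Submodule.mem_sup_left ⟨d, rfl⟩

theorem degenerate_le_nullChains (X : Type u) [Quandle X] (n : ℕ) :
    degenerate X n ≤ nullChains X n :=
  le_sup_right

/-- All data are given on rack chains, where they can be computed, and pass to the quotient by the
degenerate chains. -/
theorem exists_zmod_injective_quandle {X : Type} [Quandle X] {n p N : ℕ} [Fact p.Prime]
    (hN : 0 < N) (c : RackChain X (n + 1)) (hc : boundary X n c = 0)
    (hNc : N • c ∈ nullChains X (n + 1)) (θ : RackChain X (n + 1) →ₗ[ℤ] ZMod p)
    (hθ : ∀ e, θ (boundary X (n + 1) e) = 0) (hdeg : ∀ e ∈ degenerate X (n + 1), θ e = 0)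
    (hne : θ c ≠ 0) : ∃ f : ZMod p →+ H Theory.Q (n + 1) X, Function.Injective f := by
  obtain ⟨_, ⟨d, rfl⟩, e, he, hde⟩ := Submodule.mem_sup.1 hNc
  have hd : ∀ k, (complex Theory.Q X).d (k + 1) k = ModuleCat.ofHom (quandleBoundary X k) := by
    intro k
    simp only [complex, quandleComplex, ChainComplex.of_d]
  refine exists_zmod_injective_homology (complex Theory.Q X) n hN
    (Submodule.Quotient.mk c : RackChain X (n + 1) ⧸ degenerate X (n + 1)) ?_
    (Submodule.Quotient.mk d : RackChain X (n + 2) ⧸ degenerate X (n + 2)) ?_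
    ((degenerate X (n + 1)).liftQ θ hdeg) ?_ hne
  · rw [hd]
    change Submodule.Quotient.mk (boundary X n c) = (0 : RackChain X n ⧸ degenerate X n)
    rw [hc, Submodule.Quotient.mk_zero]
  · rw [hd]
    change Submodule.Quotient.mk (boundary X (n + 1) d) =
      (Submodule.Quotient.mk (N • c) : RackChain X (n + 1) ⧸ degenerate X (n + 1))
    rw [← hde, eq_comm, Submodule.Quotient.eq]
    simpa using he
  · intro y
    rw [hd]
    obtain ⟨y, rfl⟩ := Submodule.Quotient.mk_surjective (degenerate X (n + 2)) y
    exact hθ y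

/-! ### Appending and prepending entries -/

section Operations

variable {X : Type u}

/-- The linear map `(x₁, …, xₙ) ↦ (x₁, …, xₙ, y)`. -/
def snocMap (y : X) (n : ℕ) : RackChain X n →ₗ[ℤ] RackChain X (n + 1) :=
  Finsupp.lmapDomain ℤ ℤ fun x => (Fin.snoc x y : Fin (n + 1) → X)

/-- The linear map `(x₁, …, xₙ) ↦ (r, x₁, …, xₙ)`. -/
def consMap (r : X) (n : ℕ) : RackChain X n →ₗ[ℤ] RackChain X (n + 1) :=
  Finsupp.lmapDomain ℤ ℤ fun x => (Fin.cons r x : Fin (n + 1) → X)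

/-- The linear map `(x₁, …, xₙ) ↦ ∑ᵣ (r, x₁, …, xₙ)`. -/
def consSum (X : Type u) [Fintype X] (n : ℕ) : RackChain X n →ₗ[ℤ] RackChain X (n + 1) :=
  ∑ r : X, consMap r n

theorem snocMap_single (y : X) (n : ℕ) (x : Fin n → X) (c : ℤ) :
    snocMap y n (Finsupp.single x c) = Finsupp.single (Fin.snoc x y : Fin (n + 1) → X) c := by
  simp [snocMap, Finsupp.mapDomain_single]

theorem consMap_single (r : X) (n : ℕ) (x : Fin n → X) (c : ℤ) :
    consMap r n (Finsupp.single x c) = Finsupp.single (Fin.cons r x : Fin (n + 1) → X) c := by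
  simp [consMap, Finsupp.mapDomain_single]

theorem snocMap_degenerate (y : X) (n : ℕ) :
    degenerate X n ≤ (degenerate X (n + 1)).comap (snocMap y n) := by
  refine Submodule.span_le.2 ?_
  rintro _ ⟨x, ⟨i, j, hij, h⟩, rfl⟩
  refine Submodule.subset_span ⟨Fin.snoc x y, ⟨i.castSucc, j.castSucc, hij, ?_⟩, ?_⟩
  · simpa using h
  · rw [snocMap_single]

theorem consSum_degenerate [Fintype X] (n : ℕ) :
    degenerate X n ≤ (degenerate X (n + 1)).comap (consSum X n) := by
  refine Submodule.span_le.2 ?_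
  rintro _ ⟨x, ⟨i, j, hij, h⟩, rfl⟩
  simp only [SetLike.mem_coe, Submodule.mem_comap, consSum, LinearMap.sum_apply]
  refine Submodule.sum_mem _ fun r _ =>
    Submodule.subset_span ⟨Fin.cons r x, ⟨i.succ, j.succ, by simpa using hij, ?_⟩, ?_⟩
  · simpa using h
  · rw [consMap_single]

theorem face0_castSucc_snoc (y : X) (n : ℕ) (x : Fin (n + 1) → X) (i : Fin (n + 1)) :
    face0 i.castSucc (Fin.snoc x y : Fin (n + 2) → X) = Fin.snoc (face0 i x) y := by
  funext j
  refine Fin.lastCases ?_ (fun j => ?_) j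
  · simp [face0]
  · simp [face0, Fin.castSucc_succAbove_castSucc]

variable [Quandle X]

/-- Right multiplication `x ↦ x * y`. -/
def rightMul (y : X) : ShelfHom X X where
  toFun x := op x y
  map_act' := Shelf.self_distrib

/-- The linear map `(x₁, …, xₙ) ↦ (x₁ * y, …, xₙ * y)`. -/
def actMap (y : X) (n : ℕ) : RackChain X n →ₗ[ℤ] RackChain X n :=
  (ofHom (rightMul y)).f n

theorem actMap_single (y : X) (n : ℕ) (x : Fin n → X) (c : ℤ) :
    actMap y n (Finsupp.single x c) = Finsupp.single (fun j => op (x j) y) c :=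
  ofHom_f_single _ _ _ _

theorem actMap_boundary (y : X) (n : ℕ) (w : RackChain X (n + 1)) :
    actMap y n (boundary X n w) = boundary X n (actMap y (n + 1) w) :=
  (ofHom (rightMul y)).comm n w

theorem actMap_degenerate (y : X) (n : ℕ) :
    degenerate X n ≤ (degenerate X n).comap (actMap y n) :=
  (ofHom (rightMul y)).deg n

theorem face1_castSucc_snoc (y : X) (n : ℕ) (x : Fin (n + 1) → X) (i : Fin (n + 1)) :
    face1 i.castSucc (Fin.snoc x y : Fin (n + 2) → X) = Fin.snoc (face1 i x) y := by
  funext j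
  refine Fin.lastCases ?_ (fun j => ?_) j
  · simp [face1, not_lt.2 (Fin.le_last i)]
  · simp [face1, Fin.castSucc_succAbove_castSucc]

/-- The faces at the old entries commute with appending `y`, and the new last entry contributes w -
w * y. Thus appending `y` is a homotopy between the identity and the action of `y`. -/
theorem boundary_snocMap (y : X) (n : ℕ) (w : RackChain X (n + 1)) :
    boundary X (n + 1) (snocMap y (n + 1) w) =
      snocMap y n (boundary X n w) + (-1 : ℤ) ^ n • (w - actMap y (n + 1) w) := by
  induction w using Finsupp.induction_linear with
  | zero => simp
  | add c d hc hd =>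
    simp only [map_add, hc, hd, smul_sub, smul_add]
    abel
  | single x c =>
    have h0 : face0 (Fin.last (n + 1)) (Fin.snoc x y : Fin (n + 2) → X) = x := by
      funext j
      simp [face0]
    have h1 : face1 (Fin.last (n + 1)) (Fin.snoc x y : Fin (n + 2) → X) =
        fun j => op (x j) y := by
      funext j
      simp [face1, Fin.castSucc_lt_last]
    rw [snocMap_single, boundary_single, Fin.sum_univ_castSucc, h0, h1, boundary_single,
      actMap_single, map_sum]
    congr 1
    · refine Finset.sum_congr rfl fun i _ => ?_
      rw [map_smul, map_sub, snocMap_single, snocMap_single, face0_castSucc_snoc,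
        face1_castSucc_snoc, Fin.val_castSucc]
    · congr 1
      simp only [Fin.val_last]
      ring

/-- The new first entry contributes nothing to the boundary. The other faces turn `r` into r * xᵢ,
which only permutes the sum because right multiplication is bijective; the index shift produces the
sign. -/
theorem boundary_consSum [Fintype X] (n : ℕ) (w : RackChain X (n + 1)) :
    boundary X (n + 1) (consSum X (n + 1) w) = -consSum X n (boundary X n w) := by
  induction w using Finsupp.induction_linear with
  | zero => simp
  | add c d hc hd =>
    simp only [map_add, hc, hd]
    abel
  | single x c =>
    have h0 : ∀ r (i : Fin (n + 1)), face0 i.succ (Fin.cons r x : Fin (n + 2) → X) =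
        Fin.cons r (face0 i x) := by
      intro r i
      funext j
      refine Fin.cases ?_ (fun j => ?_) j <;> simp [face0]
    have h1 : ∀ r (i : Fin (n + 1)), face1 i.succ (Fin.cons r x : Fin (n + 2) → X) =
        Fin.cons (op r (x i)) (face1 i x) := by
      intro r i
      funext j
      refine Fin.cases ?_ (fun j => ?_) j <;> simp [face1]
    have hb : ∀ r, boundary X (n + 1) (Finsupp.single (Fin.cons r x : Fin (n + 2) → X) c) =
        -∑ i : Fin (n + 1), (-1 : ℤ) ^ (i.val + 1) • (consMap r n (Finsupp.single (face0 i x) c) -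
          consMap (op r (x i)) n (Finsupp.single (face1 i x) c)) := by
      intro r
      rw [boundary_single, Fin.sum_univ_succ, face0_zero_eq_face1_zero, sub_self, smul_zero,
        zero_add, ← Finset.sum_neg_distrib]
      refine Finset.sum_congr rfl fun i _ => ?_
      rw [h0, h1, consMap_single, consMap_single, Fin.val_succ, pow_succ]
      simp
    have hs : ∀ (y : X) (v : RackChain X n), ∑ r : X, consMap (op r y) n v = consSum X n v := by
      intro y v
      rw [consSum, LinearMap.sum_apply]
      exact Equiv.sum_comp (Rack.act' y) fun r => consMap r n v
    calc boundary X (n + 1) (consSum X (n + 1) (Finsupp.single x c))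
        = ∑ r : X, boundary X (n + 1) (Finsupp.single (Fin.cons r x : Fin (n + 2) → X) c) := by
          simp only [consSum, LinearMap.sum_apply, map_sum, consMap_single]
      _ = -∑ i : Fin (n + 1), (-1 : ℤ) ^ (i.val + 1) •
            (consSum X n (Finsupp.single (face0 i x) c) -
              consSum X n (Finsupp.single (face1 i x) c)) := by
          simp only [hb, Finset.sum_neg_distrib]
          rw [Finset.sum_comm]
          congr 1
          refine Finset.sum_congr rfl fun i _ => ?_
          rw [← Finset.smul_sum, Finset.sum_sub_distrib, hs]
          simp only [consSum, LinearMap.sum_apply]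
      _ = _ := by rw [boundary_single, map_sum]; simp only [map_smul, map_sub]

theorem sub_actMap_mem_nullChains (y : X) (n : ℕ) (w : RackChain X (n + 1))
    (hw : boundary X n w = 0) : w - actMap y (n + 1) w ∈ nullChains X (n + 1) := by
  have h := boundary_mem_nullChains (snocMap y (n + 1) w)
  rw [boundary_snocMap, hw, map_zero, zero_add] at h
  have := Submodule.smul_mem _ ((-1 : ℤ) ^ n) h
  rwa [smul_smul, ← mul_pow, neg_one_mul, neg_neg, one_pow, one_smul] at this

theorem consSum_mem_nullChains [Fintype X] (n : ℕ) {w : RackChain X (n + 1)}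
    (hw : w ∈ nullChains X (n + 1)) : consSum X (n + 1) w ∈ nullChains X (n + 2) := by
  obtain ⟨_, ⟨d, rfl⟩, e, he, rfl⟩ := Submodule.mem_sup.1 hw
  rw [map_add]
  refine Submodule.add_mem _ ?_ (degenerate_le_nullChains _ _ (consSum_degenerate _ he))
  rw [← neg_neg (consSum X (n + 1) _), ← boundary_consSum]
  exact Submodule.neg_mem _ (boundary_mem_nullChains _)

/-- The linear map `w ↦ (w + w * y, y)`. -/
def symmSnoc (y : X) (n : ℕ) : RackChain X n →ₗ[ℤ] RackChain X (n + 1) :=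
  snocMap y n ∘ₗ (LinearMap.id + actMap y n)

/-- Since `y` acts as an involution, w + w * y is invariant under it, and the extra term of
`boundary_snocMap` cancels. -/
theorem boundary_symmSnoc (y : X) (hy : ∀ x, op (op x y) y = x) (n : ℕ)
    (w : RackChain X (n + 1)) :
    boundary X (n + 1) (symmSnoc y (n + 1) w) = symmSnoc y n (boundary X n w) := by
  have h2 : actMap y (n + 1) (actMap y (n + 1) w) = w := by
    induction w using Finsupp.induction_linear with
    | zero => simp
    | add c d hc hd => simp only [map_add, hc, hd]
    | single x c => simp only [actMap_single, hy]
  simp only [symmSnoc, LinearMap.comp_apply, LinearMap.add_apply, LinearMap.id_apply,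
    boundary_snocMap, map_add, h2, actMap_boundary]
  rw [← neg_sub w, smul_neg]
  abel

theorem symmSnoc_mem_nullChains (y : X) (hy : ∀ x, op (op x y) y = x) (n : ℕ)
    {w : RackChain X (n + 1)} (hw : w ∈ nullChains X (n + 1)) :
    symmSnoc y (n + 1) w ∈ nullChains X (n + 2) := by
  obtain ⟨_, ⟨d, rfl⟩, e, he, rfl⟩ := Submodule.mem_sup.1 hw
  rw [map_add, ← boundary_symmSnoc y hy]
  exact Submodule.add_mem _ (boundary_mem_nullChains _) (degenerate_le_nullChains _ _
    (snocMap_degenerate _ _ (Submodule.add_mem _ he (actMap_degenerate _ _ he))))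

end Operations

/-! ### Boundaries in low degrees -/

section Boundary

variable {X : Type u} [Shelf X]

theorem boundary_triple (x y z : X) : boundary X 2 (Finsupp.single ![x, y, z] 1) =
    (Finsupp.single ![x, z] 1 - Finsupp.single ![op x y, z] 1) -
      (Finsupp.single ![x, y] 1 - Finsupp.single ![op x z, op y z] 1) := by
  have h1 : face0 1 ![x, y, z] = ![x, z] := by ext j; fin_cases j <;> rfl
  have k1 : face1 1 ![x, y, z] =
      ![op x y, z] := by
    ext j; fin_cases j <;> rfl
  have h2 : face0 2 ![x, y, z] = ![x, y] := by ext j; fin_cases j <;> rfl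
  have k2 : face1 2 ![x, y, z] =
      ![op x z, op y z] := by
    ext j; fin_cases j <;> rfl
  rw [boundary_single, Fin.sum_univ_three, face0_zero_eq_face1_zero, h1, k1, h2, k2]
  simp
  abel

theorem boundary_quadruple (x y z w : X) : boundary X 3 (Finsupp.single ![x, y, z, w] 1) =
    (Finsupp.single ![x, z, w] 1 - Finsupp.single ![op x y, z, w] 1) -
      (Finsupp.single ![x, y, w] 1 - Finsupp.single ![op x z, op y z, w] 1) +
      (Finsupp.single ![x, y, z] 1 - Finsupp.single ![op x w, op y w, op z w] 1) := by
  have h1 : face0 1 ![x, y, z, w] = ![x, z, w] := by ext j; fin_cases j <;> rfl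
  have k1 : face1 1 ![x, y, z, w] =
      ![op x y, z, w] := by
    ext j; fin_cases j <;> rfl
  have h2 : face0 2 ![x, y, z, w] = ![x, y, w] := by ext j; fin_cases j <;> rfl
  have k2 : face1 2 ![x, y, z, w] =
      ![op x z, op y z, w] := by
    ext j; fin_cases j <;> rfl
  have h3 : face0 3 ![x, y, z, w] = ![x, y, z] := by ext j; fin_cases j <;> rfl
  have k3 : face1 3 ![x, y, z, w] =
      ![op x w, op y w, op z w] := by
    ext j; fin_cases j <;> rfl
  rw [boundary_single, Fin.sum_univ_four, face0_zero_eq_face1_zero, h1, k1, h2, k2, h3, k3]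
  simp
  abel

theorem boundary_quintuple (x y z w v : X) : boundary X 4 (Finsupp.single ![x, y, z, w, v] 1) =
    (Finsupp.single ![x, z, w, v] 1 - Finsupp.single ![op x y, z, w, v] 1) -
      (Finsupp.single ![x, y, w, v] 1 - Finsupp.single ![op x z, op y z, w, v] 1) +
      (Finsupp.single ![x, y, z, v] 1 - Finsupp.single ![op x w, op y w, op z w, v] 1) -
      (Finsupp.single ![x, y, z, w] 1 - Finsupp.single ![op x v, op y v, op z v, op w v] 1) := by
  have h1 : face0 1 ![x, y, z, w, v] = ![x, z, w, v] := by ext j; fin_cases j <;> rfl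
  have k1 : face1 1 ![x, y, z, w, v] =
      ![op x y, z, w, v] := by
    ext j; fin_cases j <;> rfl
  have h2 : face0 2 ![x, y, z, w, v] = ![x, y, w, v] := by ext j; fin_cases j <;> rfl
  have k2 : face1 2 ![x, y, z, w, v] =
      ![op x z, op y z, w, v] := by
    ext j; fin_cases j <;> rfl
  have h3 : face0 3 ![x, y, z, w, v] = ![x, y, z, v] := by ext j; fin_cases j <;> rfl
  have k3 : face1 3 ![x, y, z, w, v] =
      ![op x w, op y w, op z w, v] := by
    ext j; fin_cases j <;> rfl
  have h4 : face0 4 ![x, y, z, w, v] = ![x, y, z, w] := by ext j; fin_cases j <;> rfl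
  have k4 : face1 4 ![x, y, z, w, v] =
      ![op x v, op y v, op z v, op w v] := by
    ext j; fin_cases j <;> rfl
  rw [boundary_single, Fin.sum_univ_five, face0_zero_eq_face1_zero, h1, k1, h2, k2, h3, k3, h4, k4]
  simp
  abel

end Boundary

/-! ### Three-cocycles and the four-cocycles built from them -/

/-- The linear map on chains of degree three given by a function of three variables. -/
def cochain3 {X : Type u} {A : Type*} [AddCommGroup A] (f : X → X → X → A) :
    RackChain X 3 →ₗ[ℤ] A :=
  Finsupp.linearCombination ℤ fun x => f (x 0) (x 1) (x 2)

/-- The linear map on chains of degree four obtained from a function `f` of three variables by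
composition with the alternating sum of the faces `∂⁰ᵢ`. -/
def cochain4 {X : Type u} {A : Type*} [AddCommGroup A] (f : X → X → X → A) :
    RackChain X 4 →ₗ[ℤ] A :=
  Finsupp.linearCombination ℤ fun x =>
    f (x 0) (x 1) (x 2) - f (x 0) (x 1) (x 3) + f (x 0) (x 2) (x 3) - f (x 1) (x 2) (x 3)

/-- The condition for a function of three variables to be a quandle cocycle. -/
structure IsCocycle {X : Type u} {A : Type*} [AddCommGroup A] [Shelf X] (f : X → X → X → A) :
    Prop where
  left : ∀ x y, f x x y = 0
  right : ∀ x y, f x y y = 0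
  cocycle : ∀ x y z w, f x z w - f (op x y) z w - (f x y w - f (op x z) (op y z) w) +
    (f x y z - f (op x w) (op y w) (op z w)) = 0

namespace IsCocycle

variable {X : Type u} {A : Type*} [AddCommGroup A] [Shelf X] {f : X → X → X → A}

theorem cochain3_boundary (hf : IsCocycle f) (e : RackChain X 4) :
    cochain3 f (boundary X 3 e) = 0 := by
  suffices h : cochain3 f ∘ₗ boundary X 3 = 0 from LinearMap.congr_fun h e
  refine Finsupp.lhom_ext' fun x => LinearMap.ext_ring ?_
  obtain ⟨a, b, c, d, rfl⟩ : ∃ a b c d, x = ![a, b, c, d] :=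
    ⟨x 0, x 1, x 2, x 3, by ext j; fin_cases j <;> rfl⟩
  change cochain3 f (boundary X 3 (Finsupp.single _ 1)) = 0
  rw [boundary_quadruple,
    ← hf.cocycle a b c d]
  simp [cochain3]

theorem cochain3_degenerate (hf : IsCocycle f) (e : RackChain X 3) (he : e ∈ degenerate X 3) :
    cochain3 f e = 0 := by
  suffices h : degenerate X 3 ≤ LinearMap.ker (cochain3 f) from h he
  refine Submodule.span_le.2 ?_
  rintro _ ⟨x, ⟨i, j, hij, h⟩, rfl⟩
  simp only [SetLike.mem_coe, LinearMap.mem_ker, cochain3, Finsupp.linearCombination_single,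
    one_smul]
  fin_cases i <;> fin_cases j <;> simp at hij h <;> simp [h, hf.left, hf.right]

/-- The alternating sum of the faces ∂⁰ᵢ anticommutes with the boundary. The value is therefore, up
to sign, the alternating sum of the cocycle conditions on the five faces ∂⁰ᵢ of the tuple, which is
`h`. -/
theorem cochain4_boundary (hf : IsCocycle f) (e : RackChain X 5) :
    cochain4 f (boundary X 4 e) = 0 := by
  suffices h : cochain4 f ∘ₗ boundary X 4 = 0 from LinearMap.congr_fun h e
  refine Finsupp.lhom_ext' fun x => LinearMap.ext_ring ?_
  obtain ⟨a, b, c, d, e, rfl⟩ : ∃ a b c d e, x = ![a, b, c, d, e] :=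
    ⟨x 0, x 1, x 2, x 3, x 4, by ext j; fin_cases j <;> rfl⟩
  have h := congrArg₂ (· + ·)
    (congrArg₂ (· - ·) (congrArg₂ (· - ·) (hf.cocycle a c d e) (hf.cocycle b c d e))
      (hf.cocycle a b d e)) (congrArg₂ (· - ·) (hf.cocycle a b c e) (hf.cocycle a b c d))
  simp only [sub_zero, add_zero] at h
  change cochain4 f (boundary X 4 (Finsupp.single _ 1)) = 0
  rw [boundary_quintuple,
    ← neg_eq_zero, ← h]
  simp [cochain4]
  abel

/-- For a cycle w, the difference w - w * y is up to sign the boundary of (w, y). -/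
theorem cochain3_actMap {X : Type u} [Quandle X] {f : X → X → X → A} (hf : IsCocycle f) (y : X)
    (w : RackChain X 3) (hw : boundary X 2 w = 0) :
    cochain3 f (actMap y 3 w) = cochain3 f w := by
  have h := hf.cochain3_boundary (snocMap y 3 w)
  rw [boundary_snocMap y 2 w, hw, map_zero, zero_add, map_smul, map_sub] at h
  exact (sub_eq_zero.1 (by simpa using h)).symm

theorem cochain4_degenerate (hf : IsCocycle f) (e : RackChain X 4) (he : e ∈ degenerate X 4) :
    cochain4 f e = 0 := by
  suffices h : degenerate X 4 ≤ LinearMap.ker (cochain4 f) from h he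
  refine Submodule.span_le.2 ?_
  rintro _ ⟨x, ⟨i, j, hij, h⟩, rfl⟩
  simp only [SetLike.mem_coe, LinearMap.mem_ker, cochain4, Finsupp.linearCombination_single,
    one_smul]
  fin_cases i <;> fin_cases j <;> simp at hij h <;> simp [h, hf.left, hf.right]

end IsCocycle

/-- By `ha`, the terms with last argument `a` cancel between w and w * a; only the face omitting the
final `a` survives. -/
theorem cochain4_symmSnoc {X : Type u} {A : Type*} [AddCommGroup A] [Quandle X]
    {f : X → X → X → A} (a : X) (ha : ∀ x y, f (op x a) (op y a) a = -f x y a)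
    (w : RackChain X 3) :
    cochain4 f (symmSnoc a 3 w) = cochain3 f w + cochain3 f (actMap a 3 w) := by
  induction w using Finsupp.induction_linear with
  | zero => simp
  | add c d hc hd =>
    simp only [map_add, hc, hd]
    abel
  | single x c =>
    have hx : ∀ x : Fin 3 → X, (Fin.snoc x a : Fin 4 → X) = ![x 0, x 1, x 2, a] := by
      intro x
      ext j
      fin_cases j <;> rfl
    simp only [symmSnoc, LinearMap.comp_apply, LinearMap.add_apply, LinearMap.id_apply, map_add,
      actMap_single, snocMap_single, cochain4, cochain3, Finsupp.linearCombination_single, hx]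
    rw [← smul_add, ← smul_add]
    congr 1
    simp [ha]
    abel

/-! ### The dihedral quandle and Mochizuki's cocycle -/

section Dihedral

variable {p : ℕ}

/-- An element of `ZMod p` as an element of the dihedral quandle. -/
def toDihedral (x : ZMod p) : Quandle.Dihedral p := x

theorem op_op_dihedral (y x : Quandle.Dihedral p) : op (op x y) y = x := by
  have key (x y : ZMod p) : 2 * y - (2 * y - x) = x := by ring
  exact key x y

instance [NeZero p] : Fintype (Quandle.Dihedral p) := inferInstanceAs (Fintype (ZMod p))

/-- The generator `(x, y)` of the rack chains of the dihedral quandle. -/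
def pair (x y : ZMod p) : RackChain (Quandle.Dihedral p) 2 :=
  Finsupp.single (![x, y] : Fin 2 → ZMod p) 1

/-- The generator `(x, y, z)` of the rack chains of the dihedral quandle. -/
def triple (x y z : ZMod p) : RackChain (Quandle.Dihedral p) 3 :=
  Finsupp.single (![x, y, z] : Fin 3 → ZMod p) 1

theorem boundary_two_triple (x y z : ZMod p) :
    boundary (Quandle.Dihedral p) 2 (triple x y z) =
      pair x z - pair (2 * y - x) z - (pair x y - pair (2 * z - x) (2 * z - y)) :=
  boundary_triple (X := Quandle.Dihedral p) x y z

theorem actMap_triple (w x y z : ZMod p) :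
    actMap (toDihedral w) 3 (triple x y z) =
      triple (2 * w - x) (2 * w - y) (2 * w - z) := by
  refine (actMap_single _ _ _ _).trans ?_
  have h : (fun j => op (X := Quandle.Dihedral p) ((![x, y, z] : Fin 3 → ZMod p) j)
      (toDihedral w)) =
      (![2 * w - x, 2 * w - y, 2 * w - z] : Fin 3 → ZMod p) := by
    ext j; fin_cases j <;> rfl
  exact congrArg (fun t => Finsupp.single t (1 : ℤ)) h

/-- The integer `(r(2z - y) + r(y) - 2 r(z)) / p`, where `r` is the representative in
`{0, …, p - 1}`. -/
def carry (y z : ZMod p) : ℤ :=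
  ((2 * z - y).val + y.val - 2 * z.val : ℤ) / p

theorem carry_symm (y z : ZMod p) : carry (2 * z - y) z = carry y z := by
  rw [carry, carry, show 2 * z - (2 * z - y) = y by ring]
  congr 1
  ring

/-- Mochizuki's three-cocycle of the dihedral quandle. -/
def mochizuki (x y z : ZMod p) : ZMod p := (x - y) * carry y z

theorem mochizuki_act (a x y : Quandle.Dihedral p) :
    mochizuki (p := p) (op (X := Quandle.Dihedral p) x a) (op (X := Quandle.Dihedral p) y a) a =
      -mochizuki (p := p) x y a := by
  have key (a x y : ZMod p) : mochizuki (2 * a - x) (2 * a - y) a = -mochizuki x y a := by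
    rw [mochizuki, mochizuki, carry_symm]
    ring
  exact key a x y

theorem cochain3_triple (f : ZMod p → ZMod p → ZMod p → ZMod p) (x y z : ZMod p) :
    cochain3 (X := Quandle.Dihedral p) f (triple x y z) = f x y z := by
  refine (Finsupp.linearCombination_single _ _ _).trans (one_smul ℤ _)

variable [NeZero p]

/-! ### Torsion cycles in degrees two and three -/

/-- The chain `∑ₓ (x, x + a)`. -/
def differenceChain (a : ZMod p) : RackChain (Quandle.Dihedral p) 2 :=
  ∑ x : ZMod p, pair x (x + a)

theorem sum_pair_eq (e : ZMod p ≃ ZMod p) (g : ZMod p → ZMod p) (a : ZMod p)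
    (h : ∀ x, g x = e x + a) : ∑ x, pair (e x) (g x) = differenceChain a := by
  simp only [h]
  exact Equiv.sum_comp e fun x => pair x (x + a)

theorem boundary_sum_triple (a b : ZMod p) :
    boundary (Quandle.Dihedral p) 2 (∑ x, triple x (x + a) (x + a + b)) =
      differenceChain (a + b) - differenceChain (b - a) -
        (differenceChain a - differenceChain (-a)) := by
  simp only [map_sum, boundary_two_triple, Finset.sum_sub_distrib]
  congr 2
  · exact sum_pair_eq (Equiv.refl _) _ _ fun x => by simp [add_assoc]
  · have h := sum_pair_eq (Equiv.addRight (2 * a)) (fun x => x + a + b) (b - a) fun x => by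
      simp only [Equiv.coe_addRight]; ring
    rw [← h]
    refine Finset.sum_congr rfl fun x _ => ?_
    congr 1
    simp only [Equiv.coe_addRight]; ring
  · have h := sum_pair_eq (Equiv.addRight (2 * (a + b))) (fun x => 2 * (x + a + b) - (x + a)) (-a)
      fun x => by simp only [Equiv.coe_addRight]; ring
    rw [← h]
    refine Finset.sum_congr rfl fun x _ => ?_
    congr 1
    simp only [Equiv.coe_addRight]; ring

theorem differenceChain_zero_mem : differenceChain (0 : ZMod p) ∈
    nullChains (Quandle.Dihedral p) 2 := by
  refine degenerate_le_nullChains _ _ (Submodule.sum_mem _ fun x _ => Submodule.subset_span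
    ⟨(![x, x + 0] : Fin 2 → ZMod p), ⟨0, 1, rfl, ?_⟩, rfl⟩)
  exact (add_zero x).symm

/-- Write D(a) for `differenceChain a`, and let h be half of 1. Modulo null chains D(j + 1) - D(j)
is a constant C = D(h) - D(-h). Summing over the cycle of all j gives pC = 0, and j = 0 gives D(1) =
C because D(0) is degenerate. -/
theorem nsmul_differenceChain_one_mem (hp : Odd p) :
    p • differenceChain (1 : ZMod p) ∈ nullChains (Quandle.Dihedral p) 2 := by
  obtain ⟨h, hh⟩ : ∃ h : ZMod p, h + h = 1 := by
    obtain ⟨q, hq⟩ := hp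
    refine ⟨-q, ?_⟩
    have : ((2 * q + 1 : ℕ) : ZMod p) = 0 := by rw [← hq, ZMod.natCast_self]
    push_cast at this
    linear_combination -this
  have key : ∀ j : ZMod p, differenceChain (j + 1) - differenceChain j -
      (differenceChain h - differenceChain (-h)) ∈ nullChains (Quandle.Dihedral p) 2 := by
    intro j
    -- The steps a = h and b = j + h are chosen so that a + b = j + 1 and b - a = j.
    have := boundary_mem_nullChains (∑ x, triple x (x + h) (x + h + (j + h)))
    rwa [boundary_sum_triple, add_sub_cancel_right,
      show h + (j + h) = j + 1 by linear_combination hh] at this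
  have hsum := Submodule.sum_mem _ fun j (_ : j ∈ Finset.univ) => key j
  have hshift : ∑ j : ZMod p, differenceChain (j + 1) = ∑ j : ZMod p, differenceChain j :=
    Equiv.sum_comp (Equiv.addRight (1 : ZMod p)) differenceChain
  rw [Finset.sum_sub_distrib, Finset.sum_sub_distrib, hshift, sub_self, zero_sub,
    Submodule.neg_mem_iff, Finset.sum_const, Finset.card_univ, ZMod.card] at hsum
  have h0 := Submodule.add_mem _ (key 0) differenceChain_zero_mem
  rw [zero_add] at h0
  have h1 := Submodule.add_mem _ (Submodule.smul_of_tower_mem _ p h0) hsum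
  convert h1 using 1
  rw [← smul_add]
  congr 1
  abel

/-- The three-cycle `∑ᵢ (r, i, i + 1)`. -/
def shadowCycle (r : ZMod p) : RackChain (Quandle.Dihedral p) 3 :=
  ∑ i : ZMod p, triple r i (i + 1)

theorem boundary_shadowCycle (r : ZMod p) :
    boundary (Quandle.Dihedral p) 2 (shadowCycle r) = 0 := by
  have h1 : ∑ i : ZMod p, pair r (i + 1) = ∑ i : ZMod p, pair r i :=
    Equiv.sum_comp (Equiv.addRight (1 : ZMod p)) (pair r)
  have h2 : ∑ i : ZMod p, pair (2 * (i + 1) - r) (2 * (i + 1) - i) =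
      ∑ i : ZMod p, pair (2 * i - r) (i + 1) := by
    rw [← Equiv.sum_comp (Equiv.addRight (1 : ZMod p)) fun i => pair (2 * i - r) (i + 1)]
    refine Finset.sum_congr rfl fun i _ => ?_
    simp only [Equiv.coe_addRight]
    congr 1
    ring
  simp only [shadowCycle, map_sum, boundary_two_triple, Finset.sum_sub_distrib, h1, h2]
  abel

theorem consSum_differenceChain_one :
    consSum (Quandle.Dihedral p) 2 (differenceChain 1) = ∑ r : ZMod p, shadowCycle r := by
  simp only [consSum, differenceChain, LinearMap.sum_apply, map_sum]
  rw [Finset.sum_comm]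
  refine Finset.sum_congr rfl fun r _ => Finset.sum_congr rfl fun i _ => ?_
  refine (consMap_single _ _ _ _).trans ?_
  rfl

/-- A cycle is homologous to its image under any right multiplication. Acting by 0 and then by y is
translation by 2y, which moves `r` to `s` for a suitable y since 2 is invertible. -/
theorem shadowCycle_sub_mem (hp : Odd p) (r s : ZMod p) :
    shadowCycle r - shadowCycle s ∈ nullChains (Quandle.Dihedral p) 3 := by
  obtain ⟨y, hy⟩ : ∃ y : ZMod p, 2 * y = s - r := by
    obtain ⟨q, hq⟩ := hp
    refine ⟨-q * (s - r), ?_⟩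
    have : ((2 * q + 1 : ℕ) : ZMod p) = 0 := by rw [← hq, ZMod.natCast_self]
    push_cast at this
    linear_combination -this * (s - r)
  have h1 := sub_actMap_mem_nullChains (toDihedral 0) 2 _ (boundary_shadowCycle r)
  have h2 := sub_actMap_mem_nullChains (toDihedral y) 2 _
    (show boundary (Quandle.Dihedral p) 2 (actMap (toDihedral 0) 3
      (shadowCycle r)) = 0 by
        rw [← actMap_boundary _ 2, boundary_shadowCycle, map_zero])
  have h3 : actMap (toDihedral y) 3
      (actMap (toDihedral 0) 3 (shadowCycle r)) = shadowCycle s := by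
    simp only [shadowCycle, map_sum, actMap_triple]
    rw [← Equiv.sum_comp (Equiv.addRight (2 * y)) fun i => triple s i (i + 1)]
    refine Finset.sum_congr rfl fun i _ => ?_
    simp only [Equiv.coe_addRight]
    congr 1
    · linear_combination hy
    · ring
    · ring
  have := Submodule.add_mem _ h1 h2
  rwa [sub_add_sub_cancel, h3] at this

/-- One factor p replaces the cycle by the sum over all first entries; that sum comes from degree 2
by `consSum`, where the other factor p kills it. -/
theorem nsmul_shadowCycle_mem (hp : Odd p) (r : ZMod p) :
    (p * p) • shadowCycle r ∈ nullChains (Quandle.Dihedral p) 3 := by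
  have h1 : p • ∑ s : ZMod p, shadowCycle s ∈ nullChains (Quandle.Dihedral p) 3 := by
    have := consSum_mem_nullChains 1 (nsmul_differenceChain_one_mem hp)
    rwa [map_nsmul, consSum_differenceChain_one] at this
  have h2 : p • shadowCycle r - ∑ s : ZMod p, shadowCycle s ∈
      nullChains (Quandle.Dihedral p) 3 := by
    have := Submodule.sum_mem _ fun s (_ : s ∈ Finset.univ) => shadowCycle_sub_mem hp r s
    rwa [Finset.sum_sub_distrib, Finset.sum_const, Finset.card_univ, ZMod.card] at this
  have h3 := Submodule.add_mem _ (Submodule.smul_of_tower_mem _ p h2) h1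
  rwa [smul_sub, sub_add_cancel, smul_smul] at h3

/-! ### The cocycle condition and the values on the cycles -/

theorem mul_carry (y z : ZMod p) :
    (p : ℤ) * carry y z = (2 * z - y).val + y.val - 2 * z.val := by
  refine Int.mul_ediv_cancel' ((ZMod.intCast_zmod_eq_zero_iff_dvd _ _).1 ?_)
  push_cast
  simp only [ZMod.natCast_val, ZMod.cast_id', id]
  ring

/-- Multiplied by p, every term is a combination of representatives and these cancel. The identity
holds over ℤ, so p can be cancelled before reducing modulo p. -/
theorem carry_cocycle (y z w : ZMod p) :
    2 * carry z w - carry y w - carry (2 * z - y) w + carry y z +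
      carry (2 * w - y) (2 * w - z) = 0 := by
  have hp : (p : ℤ) ≠ 0 := Nat.cast_ne_zero.2 (NeZero.ne p)
  refine (mul_eq_zero.1 (?_ : (p : ℤ) * _ = 0)).resolve_left hp
  have h1 := mul_carry z w
  have h2 := mul_carry y w
  have h3 := mul_carry (2 * z - y) w
  have h4 := mul_carry y z
  have h5 := mul_carry (2 * w - y) (2 * w - z)
  rw [show 2 * (2 * w - z) - (2 * w - y) = 2 * w - (2 * z - y) by ring] at h5
  linear_combination 2 * h1 - h2 - h3 + h4 + h5

theorem mochizuki_isCocycle : IsCocycle (X := Quandle.Dihedral p) (mochizuki (p := p)) where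
  left x y := by
    have key (x y : ZMod p) : mochizuki x x y = 0 := by simp [mochizuki]
    exact key x y
  right x y := by
    have key (x y : ZMod p) : mochizuki x y y = 0 := by
      have : carry y y = 0 := by
        rw [carry, show 2 * y - y = y by ring]
        simp [two_mul]
      simp [mochizuki, this]
    exact key x y
  cocycle x y z w := by
    have key (x y z w : ZMod p) : mochizuki x z w - mochizuki (2 * y - x) z w -
        (mochizuki x y w - mochizuki (2 * z - x) (2 * z - y) w) +
        (mochizuki x y z - mochizuki (2 * w - x) (2 * w - y) (2 * w - z)) = 0 := by
      have h := congrArg (Int.cast : ℤ → ZMod p) (carry_cocycle y z w)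
      push_cast at h
      simp only [mochizuki]
      linear_combination (x - y) * h
    exact key x y z w

/-- Here p times the carry is the second difference of the representatives, and their first
difference is 1 except at the wrap-around i = -1, where it is 1 - p. -/
theorem carry_add_one (i : ZMod p) :
    carry i (i + 1) = (if i = -1 then 1 else 0) - (if i + 1 = -1 then 1 else 0) := by
  have hp : (p : ℤ) ≠ 0 := Nat.cast_ne_zero.2 (NeZero.ne p)
  have hval : ∀ i : ZMod p, ((i + 1).val : ℤ) = i.val + 1 - p * (if i = -1 then 1 else 0) := by
    intro i
    have hcast : i + 1 = ((i.val + 1 : ℕ) : ZMod p) := by simp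
    have hlt := ZMod.val_lt i
    rcases (show i.val + 1 ≤ p from hlt).lt_or_eq with h | h
    · have hval : (i + 1).val = i.val + 1 := by rw [hcast, ZMod.val_natCast, Nat.mod_eq_of_lt h]
      have hi : i ≠ -1 := by
        rintro rfl
        simp at hval
      simp [hval, hi]
    · have h0 : i + 1 = 0 := by rw [hcast, h, ZMod.natCast_self]
      rw [if_pos (eq_neg_of_add_eq_zero_left h0), h0, ZMod.val_zero]
      push_cast [← h]
      ring
  have h := mul_carry i (i + 1)
  rw [show 2 * (i + 1) - i = i + 1 + 1 by ring, hval (i + 1), hval i] at h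
  exact mul_left_cancel₀ hp (by linear_combination h)

theorem cochain3_shadowCycle (r : ZMod p) :
    cochain3 (X := Quandle.Dihedral p) mochizuki (shadowCycle r) = -1 := by
  obtain ⟨δ, hδ⟩ : ∃ δ : ZMod p → ZMod p, ∀ i, δ i = if i = -1 then 1 else 0 := ⟨_, fun _ => rfl⟩
  -- Summation by parts: the first two terms cancel after summing over the cyclic group, and the
  -- last contributes -1.
  have h : ∀ i : ZMod p, mochizuki r i (i + 1) =
      (r - i) * δ i - (r - (i + 1)) * δ (i + 1) - δ (i + 1) := by
    intro i
    rw [mochizuki, carry_add_one, hδ, hδ]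
    push_cast
    ring
  have h1 : ∑ i, (r - (i + 1)) * δ (i + 1) = ∑ i, (r - i) * δ i :=
    Equiv.sum_comp (Equiv.addRight (1 : ZMod p)) fun i => (r - i) * δ i
  have h2 : ∑ i, δ (i + 1) = ∑ i, δ i := Equiv.sum_comp (Equiv.addRight (1 : ZMod p)) δ
  simp only [shadowCycle, map_sum, cochain3_triple, h, Finset.sum_sub_distrib]
  rw [h1, h2]
  simp [hδ]

theorem exists_zmod_injective_H_three [Fact p.Prime] (hp : Odd p) :
    ∃ f : ZMod p →+ H Theory.Q 3 (Quandle.Dihedral p), Function.Injective f := by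
  refine exists_zmod_injective_quandle (Nat.mul_pos (NeZero.pos p) (NeZero.pos p))
    (shadowCycle (0 : ZMod p)) (boundary_shadowCycle 0) (nsmul_shadowCycle_mem hp 0)
    (cochain3 (X := Quandle.Dihedral p) mochizuki) mochizuki_isCocycle.cochain3_boundary
    mochizuki_isCocycle.cochain3_degenerate ?_
  rw [cochain3_shadowCycle]
  exact neg_ne_zero.2 one_ne_zero

theorem exists_zmod_injective_H_four [Fact p.Prime] (hp : Odd p) :
    ∃ f : ZMod p →+ H Theory.Q 4 (Quandle.Dihedral p), Function.Injective f := by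
  refine exists_zmod_injective_quandle (Nat.mul_pos (NeZero.pos p) (NeZero.pos p))
    (symmSnoc (toDihedral 0) 3 (shadowCycle (0 : ZMod p))) ?_ ?_
    (cochain4 (X := Quandle.Dihedral p) mochizuki) mochizuki_isCocycle.cochain4_boundary
    mochizuki_isCocycle.cochain4_degenerate ?_
  · rw [boundary_symmSnoc _ (op_op_dihedral _) 2, boundary_shadowCycle, map_zero]
  · rw [← map_nsmul]
    exact symmSnoc_mem_nullChains _ (op_op_dihedral _) _ (nsmul_shadowCycle_mem hp 0)
  · rw [cochain4_symmSnoc _ (mochizuki_act _),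
      mochizuki_isCocycle.cochain3_actMap _ _ (boundary_shadowCycle 0),
      cochain3_shadowCycle]
    -- The value is -1 + -1 = -2, so its vanishing would force p = 2.
    intro h
    have h2 : ((2 : ℕ) : ZMod p) = 0 := by
      push_cast
      linear_combination -h
    rw [ZMod.natCast_eq_zero_iff] at h2
    have := Nat.le_of_dvd two_pos h2
    have := (Fact.out : p.Prime).two_le
    obtain rfl : p = 2 := by omega
    exact absurd hp (by decide)

end Dihedral

/-- Quandle homology of `R_{mk}` contains a copy of `ZMod k` if that of `R_k` does. -/
theorem exists_zmod_injective_mul {m k n : ℕ} (h : Nat.Coprime m k) (W : Theory)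
    (hk : ∃ f : ZMod k →+ H W n (Quandle.Dihedral k), Function.Injective f) :
    ∃ f : ZMod k →+ H W n (Quandle.Dihedral (m * k)), Function.Injective f := by
  obtain ⟨f, hf⟩ := hk
  refine ⟨((ChainHom.ofHom (inclRight h 0)).homology W n).comp f, ?_⟩
  exact (Function.LeftInverse.injective
    (homology_ofHom_leftInverse _ _ (projRight_inclRight h 0) W n)).comp hf

end QuandleHomology

end

theorem corollary35 :
    (∀ m k : ℕ, 0 < m → 0 < k → Nat.Coprime m k →
      Nonempty (ZMod (m * k) ≃+ ZMod m × ZMod k) ∧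
      ∀ (W : QuandleHomology.Theory) (n : ℕ),
        ∃ f : QuandleHomology.torH W n (Quandle.Dihedral m) ×
              QuandleHomology.torH W n (Quandle.Dihedral k) →+
            QuandleHomology.H W n (Quandle.Dihedral (m * k)),
          Function.Injective f) ∧
    (∀ k : ℕ, Odd k → ∀ (W : QuandleHomology.Theory) (n : ℕ),
      ∃ f : QuandleHomology.torH W n (Quandle.Dihedral k) ×
            QuandleHomology.torH W n (Quandle.Dihedral k) →+
          QuandleHomology.H W n (Quandle.Dihedral (2 * k)),
        Function.Injective f) ∧
    (∀ m k : ℕ, k.Prime → Odd k → Nat.Coprime m k →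
      (∃ f : ZMod k →+
          QuandleHomology.H QuandleHomology.Theory.Q 3 (Quandle.Dihedral (m * k)),
        Function.Injective f) ∧
      (∃ f : ZMod k →+
          QuandleHomology.H QuandleHomology.Theory.Q 4 (Quandle.Dihedral (m * k)),
        Function.Injective f)) := by
  refine ⟨fun m k _ _ h => ⟨⟨(ZMod.chineseRemainder h).toAddEquiv⟩,
      QuandleHomology.exists_injective_torH_prod h⟩,
    fun k hk => QuandleHomology.exists_injective_torH_prod_self hk.coprime_two_left,
    fun m k hp hk h => ?_⟩
  have : Fact k.Prime := ⟨hp⟩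
  exact ⟨QuandleHomology.exists_zmod_injective_mul h _
      (QuandleHomology.exists_zmod_injective_H_three hk),
    QuandleHomology.exists_zmod_injective_mul h _
      (QuandleHomology.exists_zmod_injective_H_four hk)⟩
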